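/- Let $\mathcal A$ be a finite alphabet with $|\mathcal A|\ge 2$, and equip $\mathcal A^{\mathbb Z}$ with the product of the discrete topologies and with the shift $T$, $(Tx)_i=x_{i+1}$. For $\omega\in\mathcal A^{\mathbb Z}$ let $\mathcal O_\omega$ be the closure of $\{T^n\omega : n\in\mathbb Z\}$. Suppose that $(\mathcal O_\omega,T)$ is a Cantor minimal system, i.e. $\mathcal O_\omega$ is a Cantor space (compact, metrizable, totally disconnected, without isolated points) and it is the only non-empty closed $T$-invariant subset of itself. Let $(E_{\mathbb Z},\mathcal L_\omega)$ be the labeled graph with vertices $v_n$ and edges $e_n$ ($n\in\mathbb Z$), where $e_n$ goes from $v_n$ to $v_{n+1}$ and has the label $\mathcal L_\omega(e_n)=\omega_n$. For a word $\alpha=\alpha_1\cdots\alpha_k$, $k\ge 1$, and a set $A$ of vertices, let $r(A,\alpha)$ be the set of the ranges of all paths labeled $\alpha$ with source in $A$, and let $r(\alpha)$ be the set of the ranges of all paths labeled $\alpha$; the labeled paths are the words that label at least one path. Let $\overline{\mathcal E}_{\mathbb Z}$ be the smallest family of sets of vertices that contains $r(\alpha)$ for every labeled path $\alpha$ and is closed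 under $A\mapsto r(A,\alpha)$ for labeled paths $\alpha$ and under finite unions, finite intersections and relative complements. Let $C^*(E_{\mathbb Z},\mathcal L_\omega,\overline{\mathcal E}_{\mathbb Z})$ be the $C^*$-algebra generated by a universal family of projections $p_A$ ($A\in\overline{\mathcal E}_{\mathbb Z}$) and partial isometries $s_a$ ($a\in\mathcal A$) such that, for all $A,B\in\overline{\mathcal E}_{\mathbb Z}$ and $a,b\in\mathcal A$: (i) $p_\emptyset=0$, $p_Ap_B=p_{A\cap B}$ and $p_{A\cup B}=p_A+p_B-p_{A\cap B}$; (ii) $p_As_a=s_ap_{r(A,a)}$; (iii) $s_a^*s_a=p_{r(a)}$, and $s_a^*s_b=0$ if $a\ne b$; (iv) $p_A=\sum_a s_ap_{r(A,a)}s_a^*$, where $a$ runs over the labels of the edges with source in $A$. Let $\gamma$ be its gauge action, the action of the circle group $\mathbb T$ by automorphisms with $\gamma_z(s_a)=zs_a$ and $\gamma_z(p_A)=p_A$, and let $C^*(E_{\mathbb Z},\mathcal L_\omega,\overline{\mathcal E}_{\mathbb Z})^\gamma$ be its fixed point algebra. Let $C(\mathcal O_\omega)\rtimes_T\mathbb Z$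 be the crossed product by the automorphism $f\mapsto f\circ T^{-1}$ of $C(\mathcal O_\omega)$, which contains $C(\mathcal O_\omega)$ canonically. Then there is a $*$-isomorphism $$\pi:C^*(E_{\mathbb Z},\mathcal L_\omega,\overline{\mathcal E}_{\mathbb Z})\to C(\mathcal O_\omega)\rtimes_T\mathbb Z$$ whose restriction to the fixed point algebra $C^*(E_{\mathbb Z},\mathcal L_\omega,\overline{\mathcal E}_{\mathbb Z})^\gamma$ is a $*$-isomorphism onto $C(\mathcal O_\omega)$. -/

import Mathlib

open scoped ENNReal

noncomputable section

universe uV uE u v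

/-! ### Labeled graphs -/

/-- A directed graph with vertex set `V` and edge set `E`, with a labeling map into the
alphabet `𝒜`. -/
structure LabeledGraph (V : Type uV) (E : Type uE) (𝒜 : Type u) where
  source : E → V
  range : E → V
  label : E → 𝒜

namespace LabeledGraph

variable {V : Type uV} {E : Type uE} {𝒜 : Type u} (G : LabeledGraph V E 𝒜)

/-- A finite path of length at least one, as the list of its edges. -/
def IsPath (l : List E) : Prop :=
  l ≠ [] ∧ l.IsChain fun e f => G.range e = G.source f

/-- The labeled paths `ℒ(E^{≥ 1})`. -/
def labeledPaths : Set (List 𝒜) :=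
  {α | ∃ l, G.IsPath l ∧ l.map G.label = α}

/-- The range `r(α)` of a word `α` (empty if `α` is not a labeled path). -/
def pathRange (α : List 𝒜) : Set V :=
  {w | ∃ (l : List E) (h : G.IsPath l), l.map G.label = α ∧ G.range (l.getLast h.1) = w}

/-- The relative range `r(A, α)`. -/
def relRange (A : Set V) (α : List 𝒜) : Set V :=
  {w | ∃ (l : List E) (h : G.IsPath l), l.map G.label = α ∧
    G.source (l.head h.1) ∈ A ∧ G.range (l.getLast h.1) = w}

/-- The set `ℒ(A E¹)` of the labels of the edges that start in `A`. -/
def labelsFrom (A : Set V) : Set 𝒜 :=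
  {a | ∃ e, G.source e ∈ A ∧ G.label e = a}

/-- Accommodating sets. -/
structure IsAccommodating (𝓑 : Set (Set V)) : Prop where
  relRange_mem : ∀ A ∈ 𝓑, ∀ α ∈ G.labeledPaths, G.relRange A α ∈ 𝓑
  inter_mem : ∀ A ∈ 𝓑, ∀ B ∈ 𝓑, A ∩ B ∈ 𝓑
  union_mem : ∀ A ∈ 𝓑, ∀ B ∈ 𝓑, A ∪ B ∈ 𝓑
  pathRange_mem : ∀ α ∈ G.labeledPaths, G.pathRange α ∈ 𝓑

/-- Normal accommodating sets: those closed under relative complements. -/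
structure IsNormalAccommodating (𝓑 : Set (Set V)) : Prop extends G.IsAccommodating 𝓑 where
  diff_mem : ∀ A ∈ 𝓑, ∀ B ∈ 𝓑, A \ B ∈ 𝓑

/-- The smallest normal accommodating set. -/
def Ebar : Set (Set V) :=
  ⋂₀ {𝓑 | G.IsNormalAccommodating 𝓑}

/-- The intersection of all normal accommodating sets is one of them. -/
theorem isLeast_Ebar : IsLeast {𝓑 | G.IsNormalAccommodating 𝓑} G.Ebar := by
  refine ⟨⟨⟨?_, ?_, ?_, ?_⟩, ?_⟩, fun 𝓑 h => Set.sInter_subset_of_mem h⟩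
  · exact fun A hA α hα 𝓑 h𝓑 => h𝓑.relRange_mem A (hA 𝓑 h𝓑) α hα
  · exact fun A hA B hB 𝓑 h𝓑 => h𝓑.inter_mem A (hA 𝓑 h𝓑) B (hB 𝓑 h𝓑)
  · exact fun A hA B hB 𝓑 h𝓑 => h𝓑.union_mem A (hA 𝓑 h𝓑) B (hB 𝓑 h𝓑)
  · exact fun α hα 𝓑 h𝓑 => h𝓑.pathRange_mem α hα
  · exact fun A hA B hB 𝓑 h𝓑 => h𝓑.diff_mem A (hA 𝓑 h𝓑) B (hB 𝓑 h𝓑)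

/-! ### Representations of labeled spaces -/

/-- A representation of the labeled space `(E, ℒ, 𝓑)` in a C⋆-algebra `C`: projections
`p A`, `A ∈ 𝓑`, and partial isometries `s a`, `a ∈ 𝒜`. The values `p A` for `A ∉ 𝓑` play no
role. In the last relation the sum over `ℒ(A E¹)` is imposed whenever it is finite (always, if
the alphabet is finite). -/
structure Representation (𝓑 : Set (Set V)) (C : Type v) [NonUnitalCStarAlgebra C] where
  s : 𝒜 → C
  p : Set V → C
  isStarProjection_p : ∀ A ∈ 𝓑, IsStarProjection (p A)
  partialIsometry_s : ∀ a, s a * star (s a) * s a = s a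
  p_empty : p ∅ = 0
  p_inter : ∀ A ∈ 𝓑, ∀ B ∈ 𝓑, p A * p B = p (A ∩ B)
  p_union : ∀ A ∈ 𝓑, ∀ B ∈ 𝓑, p (A ∪ B) = p A + p B - p (A ∩ B)
  p_mul_s : ∀ A ∈ 𝓑, ∀ a, p A * s a = s a * p (G.relRange A [a])
  star_s_mul_self : ∀ a, star (s a) * s a = p (G.pathRange [a])
  star_s_mul_of_ne : ∀ a b, a ≠ b → star (s a) * s b = 0
  p_eq_sum : ∀ A ∈ 𝓑, ∀ h : (G.labelsFrom A).Finite,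
    p A = ∑ a ∈ h.toFinset, s a * p (G.relRange A [a]) * star (s a)

end LabeledGraph

theorem norm_le_one_of_partialIsometry {C : Type v} [NonUnitalCStarAlgebra C] {x : C}
    (hx : x * star x * x = x) : ‖x‖ ≤ 1 := by
  have h : IsStarProjection (star x * x) :=
    ⟨by rw [IsIdempotentElem, mul_assoc, ← mul_assoc x, hx], .star_mul_self x⟩
  have h1 := h.norm_le
  rw [CStarRing.norm_star_mul_self] at h1
  nlinarith [norm_nonneg x]

theorem circle_mul_star (z : Circle) : (z : ℂ) * star (z : ℂ) = 1 := by
  have h := Circle.coe_inv_eq_conj z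
  rw [starRingEnd_apply] at h
  rw [← h, ← Circle.coe_mul, mul_inv_cancel, Circle.coe_one]

theorem circle_star_mul (z : Circle) : star (z : ℂ) * (z : ℂ) = 1 := by
  rw [mul_comm, circle_mul_star]

namespace LabeledGraph

variable {V : Type uV} {E : Type uE} {𝒜 : Type u} (G : LabeledGraph V E 𝒜)
  (𝓑 : Set (Set V))

/-- The representation `s a ↦ z • s a`, `p A ↦ p A`. -/
def Representation.twist {G : LabeledGraph V E 𝒜} {𝓑 : Set (Set V)} {C : Type v}
    [NonUnitalCStarAlgebra C] (ρ : G.Representation 𝓑 C) (z : Circle) :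
    G.Representation 𝓑 C where
  s a := (z : ℂ) • ρ.s a
  p := ρ.p
  isStarProjection_p := ρ.isStarProjection_p
  partialIsometry_s a := by
    rw [star_smul, smul_mul_smul_comm, circle_mul_star, one_smul, mul_smul_comm,
      ρ.partialIsometry_s]
  p_empty := ρ.p_empty
  p_inter := ρ.p_inter
  p_union := ρ.p_union
  p_mul_s A hA a := by rw [mul_smul_comm, smul_mul_assoc, ρ.p_mul_s A hA]
  star_s_mul_self a := by
    rw [star_smul, smul_mul_smul_comm, circle_star_mul, one_smul, ρ.star_s_mul_self]
  star_s_mul_of_ne a b h := by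
    rw [star_smul, smul_mul_smul_comm, ρ.star_s_mul_of_ne a b h, smul_zero]
  p_eq_sum A hA h := by
    rw [ρ.p_eq_sum A hA h]
    refine Finset.sum_congr rfl fun a _ => ?_
    rw [star_smul, smul_mul_assoc, smul_mul_smul_comm, circle_mul_star, one_smul]

theorem Representation.twist_twist {G : LabeledGraph V E 𝒜} {𝓑 : Set (Set V)} {C : Type v}
    [NonUnitalCStarAlgebra C] (ρ : G.Representation 𝓑 C) (z w : Circle) :
    (ρ.twist z).twist w = ρ.twist (z * w) := by
  simp only [Representation.twist, smul_smul, Circle.coe_mul, mul_comm]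

theorem Representation.twist_one {G : LabeledGraph V E 𝒜} {𝓑 : Set (Set V)} {C : Type v}
    [NonUnitalCStarAlgebra C] (ρ : G.Representation 𝓑 C) :
    ρ.twist 1 = ρ := by
  simp only [Representation.twist, Circle.coe_one, one_smul]

/-! ### The labeled graph C⋆-algebra -/

/-- A C⋆-algebra together with a representation of `(E, ℒ, 𝓑)` in it. (The universe is large
enough to contain a copy of the C⋆-algebra generated by any representation.) -/
structure RepIndex where
  alg : Type (max uV uE u)
  [inst : NonUnitalCStarAlgebra alg]
  rep : G.Representation 𝓑 alg

instance (i : G.RepIndex 𝓑) : NonUnitalCStarAlgebra i.alg := i.inst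

/-- The C⋆-algebra of bounded families indexed by all representations. -/
abbrev RepProduct := lp (fun i : G.RepIndex 𝓑 => i.alg) ∞

/-- The family `(s a)` of all representations. -/
def prodS (a : 𝒜) : G.RepProduct 𝓑 :=
  ⟨fun i => i.rep.s a, memℓp_infty ⟨1, by
    rintro _ ⟨i, rfl⟩
    exact norm_le_one_of_partialIsometry (i.rep.partialIsometry_s a)⟩⟩

/-- The family `(p A)` of all representations. -/
def prodP (A : 𝓑) : G.RepProduct 𝓑 :=
  ⟨fun i => i.rep.p A, memℓp_infty ⟨1, by
    rintro _ ⟨i, rfl⟩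
    exact (i.rep.isStarProjection_p A A.2).norm_le⟩⟩

/-- The C⋆-algebra generated by the product of all representations. -/
def generatedSubalgebra : NonUnitalStarSubalgebra ℂ (G.RepProduct 𝓑) :=
  (NonUnitalStarAlgebra.adjoin ℂ
    (Set.range (G.prodS 𝓑) ∪ Set.range (G.prodP 𝓑))).topologicalClosure

instance : IsClosed (G.generatedSubalgebra 𝓑 : Set (G.RepProduct 𝓑)) :=
  NonUnitalStarSubalgebra.isClosed_topologicalClosure _

/-- The labeled graph C⋆-algebra `C*(E, ℒ, 𝓑)`: the C⋆-algebra generated by the universal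
representation, which is the product of all representations. -/
def CStar : Type (max uV uE u + 1) := G.generatedSubalgebra 𝓑

instance : NonUnitalCStarAlgebra (G.CStar 𝓑) :=
  inferInstanceAs (NonUnitalCStarAlgebra (G.generatedSubalgebra 𝓑))

theorem prodS_mem (a : 𝒜) : G.prodS 𝓑 a ∈ G.generatedSubalgebra 𝓑 :=
  NonUnitalStarSubalgebra.le_topologicalClosure _
    (NonUnitalStarAlgebra.subset_adjoin ℂ _ (Or.inl ⟨a, rfl⟩))

theorem prodP_mem (A : 𝓑) : G.prodP 𝓑 A ∈ G.generatedSubalgebra 𝓑 :=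
  NonUnitalStarSubalgebra.le_topologicalClosure _
    (NonUnitalStarAlgebra.subset_adjoin ℂ _ (Or.inr ⟨A, rfl⟩))

/-- The canonical generators `s_a` of `C*(E, ℒ, 𝓑)`. -/
def genS (a : 𝒜) : G.CStar 𝓑 := ⟨G.prodS 𝓑 a, G.prodS_mem 𝓑 a⟩

/-- The canonical generators `p_A` of `C*(E, ℒ, 𝓑)`. -/
def genP (A : 𝓑) : G.CStar 𝓑 := ⟨G.prodP 𝓑 A, G.prodP_mem 𝓑 A⟩

/-- The universal property: every representation is the image of the canonical one. -/
theorem exists_hom_of_representation {C : Type (max uV uE u)} [NonUnitalCStarAlgebra C]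
    (ρ : G.Representation 𝓑 C) :
    ∃ f : G.CStar 𝓑 →⋆ₙₐ[ℂ] C,
      (∀ a, f (G.genS 𝓑 a) = ρ.s a) ∧ ∀ A : 𝓑, f (G.genP 𝓑 A) = ρ.p A :=
  ⟨{ toFun := fun x => x.1 ⟨C, ρ⟩
     map_smul' := fun _ _ => rfl
     map_zero' := rfl
     map_add' := fun _ _ => rfl
     map_mul' := fun _ _ => rfl
     map_star' := fun _ => rfl }, fun _ => rfl, fun _ => rfl⟩

/-! ### The gauge action -/

/-- Precomposition of a bounded family with the twist by `z`. -/
def twistProd (z : Circle) : G.RepProduct 𝓑 →⋆ₙₐ[ℂ] G.RepProduct 𝓑 where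
  toFun x := ⟨fun i => x ⟨i.alg, i.rep.twist z⟩, memℓp_infty ⟨‖x‖, by
    rintro _ ⟨i, rfl⟩
    exact lp.norm_apply_le_norm ENNReal.top_ne_zero x ⟨i.alg, i.rep.twist z⟩⟩⟩
  map_smul' _ _ := rfl
  map_zero' := rfl
  map_add' _ _ := rfl
  map_mul' _ _ := rfl
  map_star' _ := rfl

theorem twistProd_prodS (z : Circle) (a : 𝒜) :
    G.twistProd 𝓑 z (G.prodS 𝓑 a) = (z : ℂ) • G.prodS 𝓑 a := rfl

theorem twistProd_prodP (z : Circle) (A : 𝓑) :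
    G.twistProd 𝓑 z (G.prodP 𝓑 A) = G.prodP 𝓑 A := rfl

theorem twistProd_twistProd (z w : Circle) (x : G.RepProduct 𝓑) :
    G.twistProd 𝓑 z (G.twistProd 𝓑 w x) = G.twistProd 𝓑 (z * w) x := by
  ext i
  exact congrArg (fun r : G.Representation 𝓑 i.alg => (x ⟨i.alg, r⟩ : i.alg))
    (i.rep.twist_twist z w)

theorem twistProd_one (x : G.RepProduct 𝓑) : G.twistProd 𝓑 1 x = x := by
  ext i
  exact congrArg (fun r : G.Representation 𝓑 i.alg => (x ⟨i.alg, r⟩ : i.alg))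
    i.rep.twist_one

theorem continuous_twistProd (z : Circle) : Continuous (G.twistProd 𝓑 z) :=
  AddMonoidHomClass.continuous_of_bound (G.twistProd 𝓑 z) 1 fun x => by
    rw [one_mul]
    refine lp.norm_le_of_forall_le (norm_nonneg _) fun i => ?_
    exact lp.norm_apply_le_norm ENNReal.top_ne_zero x ⟨i.alg, i.rep.twist z⟩

theorem twistProd_mem (z : Circle) {x : G.RepProduct 𝓑} (hx : x ∈ G.generatedSubalgebra 𝓑) :
    G.twistProd 𝓑 z x ∈ G.generatedSubalgebra 𝓑 := by
  suffices h : G.generatedSubalgebra 𝓑 ≤ (G.generatedSubalgebra 𝓑).comap (G.twistProd 𝓑 z) from h hx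
  refine NonUnitalStarSubalgebra.topologicalClosure_minimal _ ?_ ?_
  · refine NonUnitalStarAlgebra.adjoin_le ?_
    rintro _ (⟨a, rfl⟩ | ⟨A, rfl⟩)
    · exact SMulMemClass.smul_mem (z : ℂ) (G.prodS_mem 𝓑 a)
    · exact G.prodP_mem 𝓑 A
  · exact (NonUnitalStarSubalgebra.isClosed_topologicalClosure _).preimage
      (G.continuous_twistProd 𝓑 z)

/-- The gauge action of the circle group on `C*(E, ℒ, 𝓑)`. -/
def gauge : Circle →* (G.CStar 𝓑 ≃⋆ₐ[ℂ] G.CStar 𝓑) where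
  toFun z :=
    { toFun := fun x => ⟨G.twistProd 𝓑 z x.1, G.twistProd_mem 𝓑 z x.2⟩
      invFun := fun x => ⟨G.twistProd 𝓑 z⁻¹ x.1, G.twistProd_mem 𝓑 z⁻¹ x.2⟩
      left_inv := fun x => Subtype.ext <| by
        simp only [twistProd_twistProd, inv_mul_cancel, twistProd_one]
      right_inv := fun x => Subtype.ext <| by
        simp only [twistProd_twistProd, mul_inv_cancel, twistProd_one]
      map_mul' := fun _ _ => rfl
      map_add' := fun _ _ => rfl
      map_star' := fun _ => rfl
      map_smul' := fun _ _ => rfl }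
  map_one' := by
    ext x : 1
    exact Subtype.ext (G.twistProd_one 𝓑 x.1)
  map_mul' z w := by
    ext x : 1
    exact Subtype.ext (G.twistProd_twistProd 𝓑 z w x.1).symm

theorem gauge_genS (z : Circle) (a : 𝒜) :
    G.gauge 𝓑 z (G.genS 𝓑 a) = (z : ℂ) • G.genS 𝓑 a := rfl

theorem gauge_genP (z : Circle) (A : 𝓑) :
    G.gauge 𝓑 z (G.genP 𝓑 A) = G.genP 𝓑 A := rfl

/-- The fixed point algebra `C*(E, ℒ, 𝓑)^γ` of the gauge action. -/
def gaugeFixed : NonUnitalStarSubalgebra ℂ (G.CStar 𝓑) where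
  carrier := {x | ∀ z, G.gauge 𝓑 z x = x}
  add_mem' hx hy z := by rw [map_add, hx z, hy z]
  zero_mem' z := map_zero _
  mul_mem' hx hy z := by rw [map_mul, hx z, hy z]
  smul_mem' c x hx z := by rw [map_smul, hx z]
  star_mem' hx z := by rw [map_star, hx z]

end LabeledGraph

/-! ### Crossed products by a homeomorphism -/

namespace CrossedProduct

variable {X : Type u} [TopologicalSpace X] [CompactSpace X] (T : X ≃ₜ X)

/-- A unital C⋆-algebra with a covariant representation of `(C(X), ℤ, T)` in it, where
`T` acts on `C(X)` by `f ↦ f ∘ T⁻¹`. (The universe is large enough to contain a copy of the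
C⋆-algebra generated by any covariant representation.) -/
structure CovariantIndex where
  alg : Type u
  [inst : CStarAlgebra alg]
  φ : C(X, ℂ) →⋆ₐ[ℂ] alg
  U : alg
  U_mem : U ∈ unitary alg
  covariant : ∀ f : C(X, ℂ),
    U * φ f * star U = φ (f.comp (T.symm : C(X, X)))

instance (i : CovariantIndex T) : CStarAlgebra i.alg := i.inst

/-- The C⋆-algebra of bounded families indexed by all covariant representations. -/
abbrev CovariantProduct := lp (fun i : CovariantIndex T => i.alg) ∞

/-- The family of the images of `f ∈ C(X)` under all covariant representations. -/
def prodFun (f : C(X, ℂ)) : CovariantProduct T :=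
  ⟨fun i => i.φ f, memℓp_infty ⟨‖f‖, by
    rintro _ ⟨i, rfl⟩
    exact NonUnitalStarAlgHom.norm_apply_le i.φ f⟩⟩

/-- The family of the unitaries of all covariant representations. -/
def prodU : CovariantProduct T :=
  ⟨fun i => i.U, memℓp_infty ⟨1, by
    rintro _ ⟨i, rfl⟩
    exact norm_le_one_of_partialIsometry (by
      rw [Unitary.mul_star_self_of_mem i.U_mem, one_mul])⟩⟩

/-- The C⋆-algebra generated by the product of all covariant representations. -/
def generatedSubalgebra : NonUnitalStarSubalgebra ℂ (CovariantProduct T) :=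
  (NonUnitalStarAlgebra.adjoin ℂ
    (Set.range (prodFun T) ∪ {prodU T})).topologicalClosure

instance : IsClosed (generatedSubalgebra T : Set (CovariantProduct T)) :=
  NonUnitalStarSubalgebra.isClosed_topologicalClosure _

end CrossedProduct

/-- The (full) crossed product `C(X) ⋊_T ℤ`: the C⋆-algebra generated by the universal covariant
representation, which is the product of all covariant representations. -/
def CrossedProduct {X : Type u} [TopologicalSpace X] [CompactSpace X] (T : X ≃ₜ X) :
    Type (u + 1) :=
  CrossedProduct.generatedSubalgebra T

namespace CrossedProduct

variable {X : Type u} [TopologicalSpace X] [CompactSpace X] (T : X ≃ₜ X)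

instance : NonUnitalCStarAlgebra (CrossedProduct T) :=
  inferInstanceAs (NonUnitalCStarAlgebra (generatedSubalgebra T))

theorem prodFun_mem (f : C(X, ℂ)) : prodFun T f ∈ generatedSubalgebra T :=
  NonUnitalStarSubalgebra.le_topologicalClosure _
    (NonUnitalStarAlgebra.subset_adjoin ℂ _ (Or.inl ⟨f, rfl⟩))

theorem prodU_mem : prodU T ∈ generatedSubalgebra T :=
  NonUnitalStarSubalgebra.le_topologicalClosure _
    (NonUnitalStarAlgebra.subset_adjoin ℂ _ (Or.inr rfl))

/-- The canonical map of `C(X)` into the crossed product. -/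
def incl : C(X, ℂ) →⋆ₙₐ[ℂ] CrossedProduct T where
  toFun f := ⟨prodFun T f, prodFun_mem T f⟩
  map_smul' c f := Subtype.ext <| lp.ext <| funext fun i => map_smul i.φ c f
  map_zero' := Subtype.ext <| lp.ext <| funext fun i => map_zero i.φ
  map_add' f g := Subtype.ext <| lp.ext <| funext fun i => map_add i.φ f g
  map_mul' f g := Subtype.ext <| lp.ext <| funext fun i => map_mul i.φ f g
  map_star' f := Subtype.ext <| lp.ext <| funext fun i => map_star i.φ f

/-- The canonical unitary of the crossed product. -/
def genU : CrossedProduct T := ⟨prodU T, prodU_mem T⟩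

/-- The universal property: every covariant representation is the image of the canonical one. -/
theorem exists_hom_of_covariant (i : CovariantIndex T) :
    ∃ g : CrossedProduct T →⋆ₙₐ[ℂ] i.alg, (∀ f, g (incl T f) = i.φ f) ∧ g (genU T) = i.U :=
  ⟨{ toFun := fun x => x.1 i
     map_smul' := fun _ _ => rfl
     map_zero' := rfl
     map_add' := fun _ _ => rfl
     map_mul' := fun _ _ => rfl
     map_star' := fun _ => rfl }, fun _ => rfl, rfl⟩

end CrossedProduct

/-! ### Cantor minimal systems and subshifts -/

/-- Cantor minimal systems: `X` is a Cantor space, that is a (nonempty) compact metrizable totally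
disconnected space without isolated points, and `X` is the only nonempty closed `T`-invariant
subset of `X`. -/
structure IsCantorMinimal {X : Type u} [TopologicalSpace X] (T : X ≃ₜ X) : Prop where
  nonempty : Nonempty X
  compact : CompactSpace X
  metrizable : TopologicalSpace.MetrizableSpace X
  totallyDisconnected : TotallyDisconnectedSpace X
  perfect : PerfectSpace X
  minimal : ∀ Y : Set X, IsClosed Y → Y.Nonempty → T '' Y = Y → Y = Set.univ

namespace Subshift

variable {𝒜 : Type u} [TopologicalSpace 𝒜]

/-- The shift `T` on `𝒜^ℤ`, `(T x)_i = x_{i + 1}`. -/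
def shift : (ℤ → 𝒜) ≃ₜ (ℤ → 𝒜) where
  toFun x i := x (i + 1)
  invFun x i := x (i - 1)
  left_inv x := by simp
  right_inv x := by simp
  continuous_toFun := by fun_prop
  continuous_invFun := by fun_prop

/-- The closure `𝒪_ω` of the orbit `{T^n ω : n ∈ ℤ}`. -/
def orbitClosure (ω : ℤ → 𝒜) : Set (ℤ → 𝒜) :=
  closure (Set.range fun n : ℤ => (shift ^ n : (ℤ → 𝒜) ≃ₜ (ℤ → 𝒜)) ω)

instance [DiscreteTopology 𝒜] [Finite 𝒜] (ω : ℤ → 𝒜) : CompactSpace (orbitClosure ω) :=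
  isCompact_iff_compactSpace.mp isClosed_closure.isCompact

theorem shift_image_orbitClosure (ω : ℤ → 𝒜) :
    shift '' orbitClosure ω = orbitClosure ω := by
  rw [orbitClosure, Homeomorph.image_closure, ← Set.range_comp]
  congr 1
  ext x
  constructor
  · rintro ⟨n, rfl⟩
    refine ⟨1 + n, ?_⟩
    change (shift ^ (1 + n) : (ℤ → 𝒜) ≃ₜ (ℤ → 𝒜)) ω = _
    rw [zpow_add, zpow_one]
    rfl
  · rintro ⟨n, rfl⟩
    refine ⟨-1 + n, ?_⟩
    change (shift * shift ^ (-1 + n) : (ℤ → 𝒜) ≃ₜ (ℤ → 𝒜)) ω = _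
    rw [zpow_add, zpow_neg_one, mul_inv_cancel_left]

/-- The restriction of the shift to `𝒪_ω`. -/
def orbitShift (ω : ℤ → 𝒜) : orbitClosure ω ≃ₜ orbitClosure ω :=
  (shift.image (orbitClosure ω)).trans (Homeomorph.setCongr (shift_image_orbitClosure ω))

theorem coe_orbitShift (ω : ℤ → 𝒜) (x : orbitClosure ω) (i : ℤ) :
    (orbitShift ω x : ℤ → 𝒜) i = (x : ℤ → 𝒜) (i + 1) := rfl

end Subshift

/-- The labeled graph `(E_ℤ, ℒ_ω)`: vertices `v_n` and edges `e_n` for `n ∈ ℤ`, where `e_n` goes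
from `v_n` to `v_{n + 1}` and has the label `ω_n`. -/
def sequenceGraph {𝒜 : Type u} (ω : ℤ → 𝒜) : LabeledGraph ℤ ℤ 𝒜 where
  source n := n
  range n := n + 1
  label := ω

end

open scoped ENNReal CStarAlgebra

noncomputable section

/-! ### The labeled graph of a sequence -/

namespace LabeledGraph

variable {V : Type uV} {E : Type uE} {𝒜 : Type u} (G : LabeledGraph V E 𝒜)

/-! Every vertex of the graph of `ω` has exactly one incoming and one outgoing edge. In a
representation, the initial projections of the `s a` are therefore orthogonal with sum `p univ`, and
so are the final projections; hence `S = ∑ s a` is unitary in the corner of `p univ`, and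
conjugation by `S*` sends `p A` to the projection of the translate `A + 1`. On the dynamical side,
`v_n` corresponds to the point `T^n ω`. By density of the orbit, a continuous function on the orbit
closure is determined by its values there, and every set in `Ebar` is the trace of a unique
continuous function `charFun`. The dictionary is `p A ↦ charFun A` and `s a ↦ U* · 1_{x_{-1} = a}`,
so that `S` corresponds to `U*`.

`repOfCovariant` turns covariant representations into representations of the labeled space, which
gives the homomorphism. For injectivity, `exists_covariantIndex` shows that every representation
arises in this way inside a corner. The point is to build `C(𝒪_ω) → D` out of the `p A`, which
directly describe only negative coordinates: the other cylinder projections are obtained by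
conjugation, and any finite set of them can be moved back to negative coordinates to check the
relations. Gelfand duality (`exists_hom_coord`) then yields the homomorphism. Surjectivity holds
because the range is closed and contains `U` and all cylinder functions.

For the fixed points, the isomorphism carries the gauge action to the dual action at the inverse
parameter. Averaging over roots of unity kills the monomials `f U^k` with `k ≠ 0`, so the elements
fixed by the dual action are limits of elements of `C(𝒪_ω)`. The regular representation on `ℓ²`
makes `C(𝒪_ω)` embed faithfully, hence with closed range. -/

theorem pathRange_eq_relRange_univ (α : List 𝒜) : G.pathRange α = G.relRange Set.univ α := by
  simp [pathRange, relRange]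

theorem relRange_nil (A : Set V) : G.relRange A [] = ∅ := by
  ext w
  simp only [relRange, List.map_eq_nil_iff, Set.mem_ofPred_eq, Set.mem_empty_iff_false, iff_false]
  rintro ⟨l, h, rfl, -⟩
  exact h.1 rfl

theorem mem_relRange_singleton {A : Set V} {a : 𝒜} {w : V} :
    w ∈ G.relRange A [a] ↔ ∃ e, G.label e = a ∧ G.source e ∈ A ∧ G.range e = w := by
  constructor
  · rintro ⟨l, h, hl, hs, hr⟩
    obtain ⟨e, rfl, he⟩ := List.map_eq_singleton_iff.mp hl
    exact ⟨e, he, hs, hr⟩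
  · rintro ⟨e, he, hs, hr⟩
    exact ⟨[e], ⟨by simp, by simp⟩, by simp [he], hs, hr⟩

theorem relRange_cons (A : Set V) (a b : 𝒜) (α : List 𝒜) :
    G.relRange A (a :: b :: α) = G.relRange (G.relRange A [a]) (b :: α) := by
  ext w
  constructor
  · rintro ⟨l, h, hl, hs, hr⟩
    obtain ⟨e, l, rfl, he, hl⟩ := List.map_eq_cons_iff.mp hl
    obtain ⟨f, l, rfl, hf, hl⟩ := List.map_eq_cons_iff.mp hl
    have h2 := List.isChain_cons_cons.mp h.2
    refine ⟨f :: l, ⟨by simp, h2.2⟩, by simp [hf, hl], ?_, by simpa using hr⟩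
    exact G.mem_relRange_singleton.mpr ⟨e, he, hs, h2.1⟩
  · rintro ⟨l, h, hl, hs, hr⟩
    obtain ⟨f, l, rfl, hf, hl⟩ := List.map_eq_cons_iff.mp hl
    obtain ⟨e, he, hs, her⟩ := G.mem_relRange_singleton.mp hs
    exact ⟨e :: f :: l, ⟨by simp, List.isChain_cons_cons.mpr ⟨her, h.2⟩⟩, by simp [he, hf, hl], hs,
      by simpa using hr⟩

/-- Relative ranges along a word are iterated letter by letter. The empty word is no path and gives
`∅`, which is why `h0` is required. -/
theorem relRange_mem_of_singleton {𝓑 : Set (Set V)} (h0 : ∅ ∈ 𝓑)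
    (h : ∀ A ∈ 𝓑, ∀ a, G.relRange A [a] ∈ 𝓑) (α : List 𝒜) :
    ∀ A ∈ 𝓑, G.relRange A α ∈ 𝓑 := by
  induction α with
  | nil => intro A _; rwa [relRange_nil]
  | cons a α ih =>
    intro A hA
    cases α with
    | nil => exact h A hA a
    | cons b α =>
      rw [relRange_cons]
      exact ih _ (h A hA a)

theorem relRange_singleton_of_notMem {a : 𝒜} (A : Set V) (ha : [a] ∉ G.labeledPaths) :
    G.relRange A [a] = ∅ := by
  ext w
  simp only [Set.mem_empty_iff_false, iff_false]
  rintro ⟨l, h, hl, -⟩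
  exact ha ⟨l, h, hl⟩

end LabeledGraph

/-! ### The family `Ebar` of the graph of `ω` -/

section sequenceGraph

variable {𝒜 : Type u} (ω : ℤ → 𝒜)

theorem sequenceGraph_relRange (A : Set ℤ) (a : 𝒜) :
    (sequenceGraph ω).relRange A [a] = {n | n - 1 ∈ A ∧ ω (n - 1) = a} := by
  ext n
  rw [LabeledGraph.mem_relRange_singleton]
  constructor
  · rintro ⟨e, he, hs, rfl⟩
    simpa [sequenceGraph] using ⟨hs, he⟩
  · rintro ⟨h1, h2⟩
    exact ⟨n - 1, h2, h1, by simp [sequenceGraph]⟩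

theorem sequenceGraph_pathRange (a : 𝒜) :
    (sequenceGraph ω).pathRange [a] = {n | ω (n - 1) = a} := by
  rw [LabeledGraph.pathRange_eq_relRange_univ, sequenceGraph_relRange]
  simp

theorem isNormalAccommodating_Ebar :
    (sequenceGraph ω).IsNormalAccommodating (sequenceGraph ω).Ebar :=
  (sequenceGraph ω).isLeast_Ebar.1

theorem singleton_mem_labeledPaths (n : ℤ) : [ω n] ∈ (sequenceGraph ω).labeledPaths :=
  ⟨[n], ⟨by simp, by simp⟩, rfl⟩

theorem empty_mem_Ebar : ∅ ∈ (sequenceGraph ω).Ebar := by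
  have h := (isNormalAccommodating_Ebar ω).pathRange_mem _ (singleton_mem_labeledPaths ω 0)
  simpa using (isNormalAccommodating_Ebar ω).diff_mem _ h _ h

theorem relRange_mem_Ebar {A : Set ℤ} (hA : A ∈ (sequenceGraph ω).Ebar) (a : 𝒜) :
    (sequenceGraph ω).relRange A [a] ∈ (sequenceGraph ω).Ebar := by
  by_cases h : [a] ∈ (sequenceGraph ω).labeledPaths
  · exact (isNormalAccommodating_Ebar ω).relRange_mem A hA _ h
  · rw [LabeledGraph.relRange_singleton_of_notMem _ _ h]
    exact empty_mem_Ebar ω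

theorem pathRange_mem_Ebar (a : 𝒜) :
    (sequenceGraph ω).pathRange [a] ∈ (sequenceGraph ω).Ebar := by
  by_cases h : [a] ∈ (sequenceGraph ω).labeledPaths
  · exact (isNormalAccommodating_Ebar ω).pathRange_mem _ h
  · rw [LabeledGraph.pathRange_eq_relRange_univ, LabeledGraph.relRange_singleton_of_notMem _ _ h]
    exact empty_mem_Ebar ω

theorem biUnion_mem_Ebar {ι : Type*} (F : Finset ι) (A : ι → Set ℤ)
    (hA : ∀ i, A i ∈ (sequenceGraph ω).Ebar) : (⋃ i ∈ F, A i) ∈ (sequenceGraph ω).Ebar := by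
  classical
  induction F using Finset.induction_on with
  | empty => simpa using empty_mem_Ebar ω
  | insert i F _ ih =>
    rw [Finset.set_biUnion_insert]
    exact (isNormalAccommodating_Ebar ω).union_mem _ (hA i) _ ih

/-- The translate `A + 1` is the union of the `r(A, a)` over the finite alphabet, since each vertex
of `A` emits exactly one edge. -/
theorem shift_mem_Ebar [Finite 𝒜] {A : Set ℤ} (hA : A ∈ (sequenceGraph ω).Ebar) :
    {n | n - 1 ∈ A} ∈ (sequenceGraph ω).Ebar := by
  have := Fintype.ofFinite 𝒜
  convert biUnion_mem_Ebar ω Finset.univ (fun a => (sequenceGraph ω).relRange A [a])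
    (relRange_mem_Ebar ω hA) using 1
  ext n
  simp [sequenceGraph_relRange]

theorem univ_mem_Ebar [Finite 𝒜] : Set.univ ∈ (sequenceGraph ω).Ebar := by
  have := Fintype.ofFinite 𝒜
  convert biUnion_mem_Ebar ω Finset.univ (fun a => (sequenceGraph ω).pathRange [a])
    (pathRange_mem_Ebar ω) using 1
  ext n
  simp [sequenceGraph_pathRange]

/-- Induction principle for the members of `Ebar`. -/
theorem Ebar_induction {P : Set ℤ → Prop} (univ : P Set.univ) (empty : P ∅)
    (relRange : ∀ A ∈ (sequenceGraph ω).Ebar, P A → ∀ a, P ((sequenceGraph ω).relRange A [a]))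
    (inter : ∀ A ∈ (sequenceGraph ω).Ebar, ∀ B ∈ (sequenceGraph ω).Ebar, P A → P B → P (A ∩ B))
    (union : ∀ A ∈ (sequenceGraph ω).Ebar, ∀ B ∈ (sequenceGraph ω).Ebar, P A → P B → P (A ∪ B))
    (diff : ∀ A ∈ (sequenceGraph ω).Ebar, ∀ B ∈ (sequenceGraph ω).Ebar, P A → P B → P (A \ B))
    [Finite 𝒜] {A : Set ℤ} (hA : A ∈ (sequenceGraph ω).Ebar) : P A := by
  have hE := isNormalAccommodating_Ebar ω
  have hr : ∀ (α : List 𝒜), ∀ A ∈ {A | A ∈ (sequenceGraph ω).Ebar ∧ P A},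
      (sequenceGraph ω).relRange A α ∈ {A | A ∈ (sequenceGraph ω).Ebar ∧ P A} :=
    LabeledGraph.relRange_mem_of_singleton _ ⟨empty_mem_Ebar ω, empty⟩
      fun A hA a => ⟨relRange_mem_Ebar ω hA.1 a, relRange A hA.1 hA.2 a⟩
  suffices h : (sequenceGraph ω).IsNormalAccommodating {A | A ∈ (sequenceGraph ω).Ebar ∧ P A} from
    ((sequenceGraph ω).isLeast_Ebar.2 h hA).2
  refine ⟨⟨fun A hA α _ => hr α A hA, ?_, ?_, fun α _ => ?_⟩, ?_⟩
  · exact fun A hA B hB => ⟨hE.inter_mem A hA.1 B hB.1, inter A hA.1 B hB.1 hA.2 hB.2⟩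
  · exact fun A hA B hB => ⟨hE.union_mem A hA.1 B hB.1, union A hA.1 B hB.1 hA.2 hB.2⟩
  -- Since `r(α) = r(univ, α)`, the generators of `Ebar` are covered by the cases `univ` and
  -- `relRange`.
  · rw [LabeledGraph.pathRange_eq_relRange_univ]
    exact hr α _ ⟨univ_mem_Ebar ω, univ⟩
  · exact fun A hA B hB => ⟨hE.diff_mem A hA.1 B hB.1, diff A hA.1 B hB.1 hA.2 hB.2⟩

end sequenceGraph

/-! ### Continuous functions on the orbit closure -/

namespace Subshift

variable {𝒜 : Type u} [TopologicalSpace 𝒜] (ω : ℤ → 𝒜)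

theorem shift_zpow_apply (n : ℤ) (x : ℤ → 𝒜) (i : ℤ) :
    (shift ^ n : (ℤ → 𝒜) ≃ₜ (ℤ → 𝒜)) x i = x (i + n) := by
  induction n generalizing i with
  | zero => simp
  | succ n ih =>
    rw [add_comm, zpow_add, zpow_one]
    change (shift ^ (n : ℤ) : (ℤ → 𝒜) ≃ₜ (ℤ → 𝒜)) x (i + 1) = _
    rw [ih]; congr 1; ring
  | pred n ih =>
    rw [sub_eq_neg_add, zpow_add, zpow_neg_one]
    change (shift ^ (-n : ℤ) : (ℤ → 𝒜) ≃ₜ (ℤ → 𝒜)) x (i - 1) = _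
    rw [ih]; congr 1; ring

theorem shift_mem_orbitClosure (n : ℤ) : (fun i => ω (i + n)) ∈ orbitClosure ω :=
  subset_closure ⟨n, funext (shift_zpow_apply n ω)⟩

/-- The point `T^n ω` of the orbit closure. -/
def orbitPoint (n : ℤ) : orbitClosure ω := ⟨fun i => ω (i + n), shift_mem_orbitClosure ω n⟩

theorem orbitPoint_apply (n i : ℤ) : (orbitPoint ω n : ℤ → 𝒜) i = ω (i + n) := rfl

theorem orbitShift_symm_orbitPoint (n : ℤ) :
    (orbitShift ω).symm (orbitPoint ω n) = orbitPoint ω (n - 1) := by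
  rw [Homeomorph.symm_apply_eq]
  ext i
  rw [coe_orbitShift, orbitPoint_apply, orbitPoint_apply]
  congr 1; ring

theorem denseRange_orbitPoint : DenseRange (orbitPoint ω) := by
  rw [DenseRange, Subtype.dense_iff]
  intro x hx
  convert hx using 1
  change _ = closure _
  congr 1
  rw [← Set.range_comp]
  congr 1
  funext n
  exact (funext (shift_zpow_apply n ω)).symm

theorem ext_orbitPoint {f g : C(orbitClosure ω, ℂ)}
    (h : ∀ n, f (orbitPoint ω n) = g (orbitPoint ω n)) : f = g :=
  ContinuousMap.coe_injective <|
    (denseRange_orbitPoint ω).equalizer f.continuous g.continuous (funext h)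

/-- The function `f` takes the values of the indicator function of `A` along the orbit of `ω`. -/
def Represents (f : C(orbitClosure ω, ℂ)) (A : Set ℤ) : Prop :=
  ∀ n, f (orbitPoint ω n) = A.indicator 1 n

open Classical in
/-- The function that represents `A`, if there is one. -/
def charFun (A : Set ℤ) : C(orbitClosure ω, ℂ) :=
  if h : ∃ f, Represents ω f A then h.choose else 0

variable {ω}

/-- The orbit is dense, so the representing function is unique and the choice in `charFun` is
harmless. Every computation with `charFun` goes through this. -/
theorem Represents.charFun_eq {f : C(orbitClosure ω, ℂ)} {A : Set ℤ} (h : Represents ω f A) :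
    charFun ω A = f := by
  have h' : ∃ f, Represents ω f A := ⟨f, h⟩
  rw [charFun, dif_pos h']
  exact ext_orbitPoint ω fun n => (h'.choose_spec n).trans (h n).symm

theorem Represents.inter {f g : C(orbitClosure ω, ℂ)} {A B : Set ℤ} (hf : Represents ω f A)
    (hg : Represents ω g B) : Represents ω (f * g) (A ∩ B) := fun n => by
  rw [ContinuousMap.mul_apply, hf n, hg n]
  by_cases h1 : n ∈ A <;> by_cases h2 : n ∈ B <;> simp [h1, h2]

theorem Represents.union {f g : C(orbitClosure ω, ℂ)} {A B : Set ℤ} (hf : Represents ω f A)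
    (hg : Represents ω g B) : Represents ω (f + g - f * g) (A ∪ B) := fun n => by
  rw [ContinuousMap.sub_apply, ContinuousMap.add_apply, ContinuousMap.mul_apply, hf n, hg n]
  by_cases h1 : n ∈ A <;> by_cases h2 : n ∈ B <;> simp [h1, h2]

theorem Represents.diff {f g : C(orbitClosure ω, ℂ)} {A B : Set ℤ} (hf : Represents ω f A)
    (hg : Represents ω g B) : Represents ω (f - f * g) (A \ B) := fun n => by
  rw [ContinuousMap.sub_apply, ContinuousMap.mul_apply, hf n, hg n]
  by_cases h1 : n ∈ A <;> by_cases h2 : n ∈ B <;> simp [h1, h2]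

theorem Represents.shift {f : C(orbitClosure ω, ℂ)} {A : Set ℤ} (hf : Represents ω f A) :
    Represents ω (f.comp ((orbitShift ω).symm : C(orbitClosure ω, orbitClosure ω)))
      {n | n - 1 ∈ A} := fun n => by
  change f ((orbitShift ω).symm (orbitPoint ω n)) = _
  rw [orbitShift_symm_orbitPoint, hf]
  rfl

theorem Represents.univ : Represents ω 1 Set.univ := fun n => by simp

theorem Represents.empty : Represents ω 0 ∅ := fun n => by simp

/-! ### Cylinder functions -/

variable (ω) [DiscreteTopology 𝒜]

open Classical in
/-- The indicator function of the cylinder `{x | x i = a}`. -/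
def coord (i : ℤ) (a : 𝒜) : C(orbitClosure ω, ℂ) where
  toFun x := if (x : ℤ → 𝒜) i = a then 1 else 0
  continuous_toFun :=
    (continuous_of_discreteTopology (f := fun b : 𝒜 => if b = a then (1 : ℂ) else 0)).comp
      ((continuous_apply i).comp continuous_subtype_val)

open Classical in
theorem coord_apply (i : ℤ) (a : 𝒜) (x : orbitClosure ω) :
    coord ω i a x = if (x : ℤ → 𝒜) i = a then 1 else 0 := rfl

theorem coord_comp_orbitShift_symm (i : ℤ) (a : 𝒜) :
    (coord ω i a).comp ((orbitShift ω).symm : C(orbitClosure ω, orbitClosure ω)) =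
      coord ω (i - 1) a := by
  ext x
  simp only [ContinuousMap.comp_apply, coord_apply]
  congr 2

theorem sum_coord [Fintype 𝒜] (i : ℤ) : ∑ a, coord ω i a = 1 := by
  ext x
  rw [ContinuousMap.sum_apply, Finset.sum_eq_single_of_mem ((x : ℤ → 𝒜) i) (Finset.mem_univ _)]
  · simp [coord_apply]
  · intro b _ hb
    simp [coord_apply, hb.symm]

theorem coord_mul_self (i : ℤ) (a : 𝒜) : coord ω i a * coord ω i a = coord ω i a := by
  ext x
  simp [coord_apply]

theorem star_coord (i : ℤ) (a : 𝒜) : star (coord ω i a) = coord ω i a := by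
  ext x
  simp only [ContinuousMap.star_apply, coord_apply]
  split_ifs <;> simp

theorem coord_mul_of_ne (i : ℤ) {a b : 𝒜} (h : a ≠ b) : coord ω i a * coord ω i b = 0 := by
  ext x
  simp only [ContinuousMap.mul_apply, coord_apply]
  split_ifs with h1 h2
  · exact absurd (h1.symm.trans h2) h
  all_goals simp

/-- A star subalgebra that is closed and contains the cylinder functions is everything. -/
theorem eq_top_of_coord_mem [Finite 𝒜] (S : StarSubalgebra ℂ C(orbitClosure ω, ℂ))
    (hS : IsClosed (S : Set C(orbitClosure ω, ℂ))) (h : ∀ i a, coord ω i a ∈ S) : S = ⊤ := by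
  have hsep : S.SeparatesPoints := by
    intro x y hxy
    obtain ⟨i, hi⟩ : ∃ i, (x : ℤ → 𝒜) i ≠ (y : ℤ → 𝒜) i := by
      by_contra! hc
      exact hxy (Subtype.ext (funext hc))
    refine ⟨_, ⟨coord ω i ((x : ℤ → 𝒜) i), h _ _, rfl⟩, ?_⟩
    simp [coord_apply, hi.symm]
  rw [← ContinuousMap.starSubalgebra_topologicalClosure_eq_top_of_separatesPoints S hsep]
  exact le_antisymm (StarSubalgebra.le_topologicalClosure _)
    (StarSubalgebra.topologicalClosure_minimal le_rfl hS)

/-- Two homomorphisms that agree on the cylinder functions are equal. -/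
theorem hom_ext_coord [Finite 𝒜] {D : Type*} [NonUnitalCStarAlgebra D]
    {φ ψ : C(orbitClosure ω, ℂ) →⋆ₙₐ[ℂ] D} (h : ∀ i a, φ (coord ω i a) = ψ (coord ω i a))
    (f : C(orbitClosure ω, ℂ)) : φ f = ψ f := by
  have := Fintype.ofFinite 𝒜
  have h1 : φ 1 = ψ 1 := by
    rw [← sum_coord ω 0, map_sum, map_sum]
    exact Finset.sum_congr rfl fun a _ => h 0 a
  let S : StarSubalgebra ℂ C(orbitClosure ω, ℂ) :=
    { carrier := {f | φ f = ψ f}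
      mul_mem' := fun {a b} ha hb => by
        simp only [Set.mem_ofPred_eq] at *; rw [map_mul, map_mul, ha, hb]
      add_mem' := fun {a b} ha hb => by
        simp only [Set.mem_ofPred_eq] at *; rw [map_add, map_add, ha, hb]
      algebraMap_mem' := fun r => by
        simp only [Set.mem_ofPred_eq, Algebra.algebraMap_eq_smul_one, map_smul, h1]
      star_mem' := fun {a} ha => by
        simp only [Set.mem_ofPred_eq] at *; rw [map_star, map_star, ha] }
  have hS : S = ⊤ := eq_top_of_coord_mem ω S
    (isClosed_eq (map_continuous φ) (map_continuous ψ)) h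
  have : f ∈ S := hS ▸ StarSubalgebra.mem_top
  exact this

variable {ω}

theorem represents_coord (i : ℤ) (a : 𝒜) : Represents ω (coord ω i a) {n | ω (i + n) = a} :=
  fun n => by
  classical
  rw [coord_apply, orbitPoint_apply, Set.indicator_apply]
  rfl

/-- The edge into `v_n` is `e_{n-1}`, with label `ω_{n-1} = (T^n ω)_{-1}`. This is the origin of the
coordinate `-1`. -/
theorem represents_coord_neg_one (a : 𝒜) :
    Represents ω (coord ω (-1) a) ((sequenceGraph ω).pathRange [a]) := by
  rw [sequenceGraph_pathRange]
  convert represents_coord (-1) a using 5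
  ring

theorem Represents.relRange {f : C(orbitClosure ω, ℂ)} {A : Set ℤ} (hf : Represents ω f A)
    (a : 𝒜) : Represents ω
      (f.comp ((orbitShift ω).symm : C(orbitClosure ω, orbitClosure ω)) * coord ω (-1) a)
      ((sequenceGraph ω).relRange A [a]) := by
  have h := hf.shift.inter (represents_coord_neg_one a)
  rw [sequenceGraph_pathRange] at h
  rwa [sequenceGraph_relRange]

/-- The sets represented by some continuous function are stable under all the operations that
generate `Ebar`. -/
theorem represents_charFun [Finite 𝒜] {A : Set ℤ} (hA : A ∈ (sequenceGraph ω).Ebar) :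
    Represents ω (charFun ω A) A := by
  suffices h : ∃ f, Represents ω f A by
    obtain ⟨f, hf⟩ := h
    rwa [hf.charFun_eq]
  refine Ebar_induction ω (P := fun A => ∃ f, Represents ω f A) ⟨1, .univ⟩ ⟨0, .empty⟩
    ?_ ?_ ?_ ?_ hA
  · rintro A - ⟨f, hf⟩ a
    exact ⟨_, hf.relRange a⟩
  · rintro A - B - ⟨f, hf⟩ ⟨g, hg⟩
    exact ⟨_, hf.inter hg⟩
  · rintro A - B - ⟨f, hf⟩ ⟨g, hg⟩
    exact ⟨_, hf.union hg⟩
  · rintro A - B - ⟨f, hf⟩ ⟨g, hg⟩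
    exact ⟨_, hf.diff hg⟩

end Subshift

/-! ### Corners -/

/-- A C⋆-algebra with a two-sided unit is a unital C⋆-algebra. -/
abbrev CStarAlgebra.ofUnit {D : Type u} [h : NonUnitalCStarAlgebra D] (e : D)
    (hl : ∀ x, e * x = x) (hr : ∀ x, x * e = x) : CStarAlgebra D :=
  letI ring : NormedRing D :=
    { h.toNonUnitalNormedRing with
      one := e
      one_mul := hl
      mul_one := hr }
  letI : Algebra ℂ D := Algebra.ofModule smul_mul_assoc mul_smul_comm
  letI algebra : NormedAlgebra ℂ D := { norm_smul_le := fun r x => norm_smul_le r x }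
  { h, ring, algebra with }

/-- The corner `p A p`. -/
def NonUnitalStarSubalgebra.corner {A : Type u} [NonUnitalCStarAlgebra A] {p : A}
    (hp : IsStarProjection p) : NonUnitalStarSubalgebra ℂ A where
  carrier := {x | p * x = x ∧ x * p = x}
  add_mem' hx hy := ⟨by rw [mul_add, hx.1, hy.1], by rw [add_mul, hx.2, hy.2]⟩
  zero_mem' := ⟨mul_zero p, zero_mul p⟩
  mul_mem' hx hy := ⟨by rw [← mul_assoc, hx.1], by rw [mul_assoc, hy.2]⟩
  smul_mem' c x hx := ⟨by rw [mul_smul_comm, hx.1], by rw [smul_mul_assoc, hx.2]⟩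
  star_mem' {x} hx :=
    ⟨by rw [← hp.isSelfAdjoint.star_eq, ← star_mul, hx.2],
      by rw [← hp.isSelfAdjoint.star_eq, ← star_mul, hx.1]⟩

/-- The target of a representation may lack a unit, or have one different from `p univ`; passing to
the corner of `p univ` makes the representation unital. -/
theorem exists_corner {A : Type u} [NonUnitalCStarAlgebra A] {p : A} (hp : IsStarProjection p) :
    ∃ (D : Type u) (_ : CStarAlgebra D) (ι : D →⋆ₙₐ[ℂ] A), Function.Injective ι ∧ ι 1 = p ∧
      ∀ x, p * x = x → x * p = x → ∃ d, ι d = x := by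
  have hcl : IsClosed (NonUnitalStarSubalgebra.corner hp : Set A) :=
    (isClosed_eq (continuous_const_mul p) continuous_id).inter
      (isClosed_eq (continuous_mul_const p) continuous_id)
  have hpp : p * p = p := hp.isIdempotentElem
  refine ⟨NonUnitalStarSubalgebra.corner hp,
    CStarAlgebra.ofUnit ⟨p, hpp, hpp⟩ (fun x => Subtype.ext x.2.1)
      (fun x => Subtype.ext x.2.2),
    { toFun := Subtype.val
      map_smul' := fun _ _ => rfl
      map_zero' := rfl
      map_add' := fun _ _ => rfl
      map_mul' := fun _ _ => rfl
      map_star' := fun _ => rfl }, Subtype.val_injective, rfl, fun x h1 h2 => ⟨⟨x, h1, h2⟩, rfl⟩⟩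

/-! ### Homomorphisms on the functions on the orbit closure -/

/-- A closed star subalgebra generated by commuting elements is commutative. -/
abbrev StarSubalgebra.closureAdjoinCommCStarAlgebra {D : Type u} [CStarAlgebra D] {s : Set D}
    (hc : ∀ a ∈ s, ∀ b ∈ s, a * b = b * a) (hs : ∀ a ∈ s, star a = a) :
    CommCStarAlgebra (StarAlgebra.adjoin ℂ s).topologicalClosure :=
  letI : CStarAlgebra (StarAlgebra.adjoin ℂ s).topologicalClosure :=
    StarSubalgebra.cstarAlgebra _ (h_closed := StarSubalgebra.isClosed_topologicalClosure _)
  { mul_comm := by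
      have := StarAlgebra.isMulCommutative_adjoin ℂ hc
        (fun a ha b hb => by rw [hs b hb]; exact hc a ha b hb)
      exact (StarSubalgebra.commRingTopologicalClosure (StarAlgebra.adjoin ℂ s)
        fun a b => this.is_comm.comm a b).mul_comm }

namespace Subshift

variable {𝒜 : Type u} [TopologicalSpace 𝒜] (ω : ℤ → 𝒜)

/-- Basic open sets of the product topology restrict only finitely many coordinates. -/
theorem mem_orbitClosure_of_forall_finset {x : ℤ → 𝒜}
    (h : ∀ F : Finset ℤ, ∃ n : ℤ, ∀ i ∈ F, ω (i + n) = x i) : x ∈ orbitClosure ω := by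
  rw [orbitClosure, mem_closure_iff]
  intro o ho hx
  obtain ⟨F, u, hu, huo⟩ := isOpen_pi_iff.mp ho x hx
  obtain ⟨n, hn⟩ := h F
  refine ⟨_, huo fun i hi => ?_, ⟨n, rfl⟩⟩
  refine (congrArg (· ∈ u i) (shift_zpow_apply n ω i)).mpr ?_
  rw [hn i hi]
  exact (hu i hi).2

/-- Commuting partitions of unity that vanish on the words that do not occur in `ω` define a
homomorphism on the continuous functions on the orbit closure. -/
theorem exists_hom_coord [DiscreteTopology 𝒜] [Fintype 𝒜] {D : Type v} [CStarAlgebra D] (q : ℤ → 𝒜 → D)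
    (hq : ∀ i a, IsStarProjection (q i a))
    (hcomm : ∀ i j a b, q i a * q j b = q j b * q i a)
    (hsum : ∀ i, ∑ a, q i a = 1)
    (horth : ∀ i a b, a ≠ b → q i a * q i b = 0)
    (hword : ∀ (w : ℤ → 𝒜) (l : List ℤ), (∀ n, ∃ i ∈ l, ω (i + n) ≠ w i) →
      (l.map fun i => q i (w i)).prod = 0) :
    ∃ φ : C(orbitClosure ω, ℂ) →⋆ₐ[ℂ] D, ∀ i a, φ (coord ω i a) = q i a := by
  classical
  let s : Set D := Set.range fun x : ℤ × 𝒜 => q x.1 x.2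
  let B := (StarAlgebra.adjoin ℂ s).topologicalClosure
  let : CommCStarAlgebra B := StarSubalgebra.closureAdjoinCommCStarAlgebra (s := s)
    (by rintro _ ⟨x, rfl⟩ _ ⟨y, rfl⟩; exact hcomm _ _ _ _)
    (by rintro _ ⟨x, rfl⟩; exact (hq _ _).isSelfAdjoint)
  let Q : ℤ → 𝒜 → B := fun i a => ⟨q i a, StarSubalgebra.le_topologicalClosure _
    (StarAlgebra.subset_adjoin ℂ s ⟨(i, a), rfl⟩)⟩
  have hQQ : ∀ i a, Q i a * Q i a = Q i a := fun i a => Subtype.ext (hq i a).isIdempotentElem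
  have hQs : ∀ i, ∑ a, Q i a = 1 := fun i => Subtype.ext <| by
    refine (AddSubmonoidClass.coe_finsetSum _ _).trans (hsum i)
  have hQo : ∀ i a b, a ≠ b → Q i a * Q i b = 0 := fun i a b h => Subtype.ext (horth i a b h)
  have hQw : ∀ (w : ℤ → 𝒜) (l : List ℤ), (∀ n, ∃ i ∈ l, ω (i + n) ≠ w i) →
      (l.map fun i => Q i (w i)).prod = 0 := fun w l h => Subtype.ext <| by
    have := hword w l h
    rw [ZeroMemClass.coe_zero, ← this]
    refine (map_list_prod B.subtype _).trans ?_
    rw [List.map_map]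
    rfl
  -- A character takes only the values `0` and `1` on projections, and its values on the `Q i a` sum
  -- to `1` over `a`. So it selects a letter at each `i`, that is, a sequence `x χ`.
  have hχ : ∀ (χ : WeakDual.characterSpace ℂ B) (i : ℤ), ∃ a, χ (Q i a) = 1 := by
    intro χ i
    by_contra! hc
    have h0 : ∀ a, χ (Q i a) = 0 := fun a => by
      have h := congrArg χ (hQQ i a)
      rw [map_mul] at h
      exact (mul_left_eq_self₀.mp h).resolve_left (hc a)
    have h := congrArg χ (hQs i)
    rw [map_sum, map_one, Finset.sum_eq_zero fun a _ => h0 a] at h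
    exact zero_ne_one h
  choose x hx using hχ
  have hx0 : ∀ χ i a, a ≠ x χ i → χ (Q i a) = 0 := fun χ i a ha => by
    have h := congrArg χ (hQo i a _ ha)
    rwa [map_mul, hx, mul_one, map_zero] at h
  -- If a finite window of `x χ` did not occur in `ω`, the corresponding product of projections
  -- would vanish, while `χ` maps it to `1`.
  have hmem : ∀ χ, x χ ∈ orbitClosure ω := fun χ => by
    refine mem_orbitClosure_of_forall_finset ω fun F => ?_
    by_contra! hc
    have h := congrArg χ (hQw (x χ) F.toList (by simpa using hc))
    rw [map_list_prod, List.map_map, map_zero] at h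
    have h1 : (F.toList.map (χ ∘ fun i => Q i (x χ i))) = F.toList.map fun _ => 1 :=
      List.map_congr_left fun i _ => hx χ i
    rw [h1] at h
    simp at h
  have hcont : Continuous fun χ => (⟨x χ, hmem χ⟩ : orbitClosure ω) := by
    refine Continuous.subtype_mk (continuous_pi fun i => ?_) _
    rw [continuous_discrete_rng]
    intro a
    have : (fun χ => x χ i) ⁻¹' {a} =
        (fun χ : WeakDual.characterSpace ℂ B => χ (Q i a)) ⁻¹' {0}ᶜ := by
      ext χ
      simp only [Set.mem_preimage, Set.mem_singleton_iff, Set.mem_compl_iff]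
      constructor
      · rintro rfl
        rw [hx]
        exact one_ne_zero
      · intro h
        by_contra hne
        exact h (hx0 χ i a (Ne.symm hne))
    rw [this]
    exact isOpen_compl_singleton.preimage (WeakDual.gelfandTransform ℂ B (Q i a)).continuous
  let g : C(WeakDual.characterSpace ℂ B, orbitClosure ω) := ⟨_, hcont⟩
  -- Pull functions back along `χ ↦ x χ`, then undo the Gelfand transform.
  let φ : C(orbitClosure ω, ℂ) →⋆ₐ[ℂ] B :=
    ((gelfandStarTransform B).symm : C(WeakDual.characterSpace ℂ B, ℂ) →⋆ₐ[ℂ] B).comp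
      (g.compStarAlgHom' ℂ ℂ)
  refine ⟨B.subtype.comp φ, fun i a => ?_⟩
  suffices h : φ (coord ω i a) = Q i a from congrArg Subtype.val h
  change (gelfandStarTransform B).symm ((coord ω i a).comp g) = _
  rw [StarAlgEquiv.symm_apply_eq]
  ext χ
  change coord ω i a (g χ) = χ (Q i a)
  rw [coord_apply]
  change (if x χ i = a then (1 : ℂ) else 0) = _
  split_ifs with h
  · rw [← h, hx]
  · rw [hx0 χ i a (Ne.symm h)]

end Subshift

/-! ### From representations to covariant representations -/

namespace LabeledGraph.Representation

/-! ### The sum of the generators in an arbitrary representation -/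

section NonUnital

variable {𝒜 : Type u} {ω : ℤ → 𝒜} {C : Type v} [NonUnitalCStarAlgebra C]
  (ρ : (sequenceGraph ω).Representation (sequenceGraph ω).Ebar C)

theorem s_mul_p_pathRange (a : 𝒜) : ρ.s a * ρ.p ((sequenceGraph ω).pathRange [a]) = ρ.s a := by
  rw [← ρ.star_s_mul_self, ← mul_assoc, ρ.partialIsometry_s]

theorem p_mul_p_of_disjoint {A B : Set ℤ} (hA : A ∈ (sequenceGraph ω).Ebar)
    (hB : B ∈ (sequenceGraph ω).Ebar) (h : A ∩ B = ∅) : ρ.p A * ρ.p B = 0 := by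
  rw [ρ.p_inter A hA B hB, h, ρ.p_empty]

theorem pathRange_inter_of_ne {a b : 𝒜} (h : a ≠ b) :
    (sequenceGraph ω).pathRange [a] ∩ (sequenceGraph ω).pathRange [b] = ∅ := by
  rw [sequenceGraph_pathRange, sequenceGraph_pathRange]
  ext n
  simp only [Set.mem_inter_iff, Set.mem_ofPred_eq, Set.mem_empty_iff_false, iff_false]
  rintro ⟨h1, h2⟩
  exact h (h1.symm.trans h2)

theorem p_diff {A B : Set ℤ} (hA : A ∈ (sequenceGraph ω).Ebar)
    (hB : B ∈ (sequenceGraph ω).Ebar) : ρ.p (A \ B) = ρ.p A - ρ.p A * ρ.p B := by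
  have hE := isNormalAccommodating_Ebar ω
  have h := ρ.p_union _ (hE.diff_mem A hA B hB) _ (hE.inter_mem A hA B hB)
  rw [Set.sdiff_union_inter, ← ρ.p_inter A hA B hB, show A \ B ∩ (A ∩ B) = ∅ by ext; simp; tauto,
    ρ.p_empty, sub_zero] at h
  exact eq_sub_of_add_eq h.symm

theorem p_biUnion {ι : Type*} (F : Finset ι) (A : ι → Set ℤ)
    (hA : ∀ i, A i ∈ (sequenceGraph ω).Ebar) (hd : ∀ i j, i ≠ j → A i ∩ A j = ∅) :
    ρ.p (⋃ i ∈ F, A i) = ∑ i ∈ F, ρ.p (A i) := by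
  classical
  induction F using Finset.induction_on with
  | empty => simpa using ρ.p_empty
  | insert i F hi ih =>
    have h0 : A i ∩ ⋃ j ∈ F, A j = ∅ := by
      simp only [Set.inter_iUnion]
      exact Set.iUnion_eq_empty.mpr fun j => Set.iUnion_eq_empty.mpr fun hj => hd i j fun h => hi (h ▸ hj)
    rw [Finset.set_biUnion_insert, ρ.p_union _ (hA i) _ (biUnion_mem_Ebar ω F A hA), h0, ρ.p_empty,
      sub_zero, ih, Finset.sum_insert hi]

theorem s_mul_p_pathRange_of_ne {a b : 𝒜} (h : a ≠ b) :
    ρ.s a * ρ.p ((sequenceGraph ω).pathRange [b]) = 0 := by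
  rw [← ρ.s_mul_p_pathRange a, mul_assoc, ρ.p_mul_p_of_disjoint (pathRange_mem_Ebar ω a)
    (pathRange_mem_Ebar ω b) (pathRange_inter_of_ne h), mul_zero]

variable [Fintype 𝒜]

theorem sum_p_pathRange : ∑ a, ρ.p ((sequenceGraph ω).pathRange [a]) = ρ.p Set.univ := by
  rw [← ρ.p_biUnion _ _ (pathRange_mem_Ebar ω) fun a b => pathRange_inter_of_ne]
  congr 1
  ext n
  simp [sequenceGraph_pathRange]

theorem p_univ_mul_s (a : 𝒜) : ρ.p Set.univ * ρ.s a = ρ.s a := by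
  rw [ρ.p_mul_s _ (univ_mem_Ebar ω), ← LabeledGraph.pathRange_eq_relRange_univ,
    ρ.s_mul_p_pathRange]

theorem s_mul_p_univ (a : 𝒜) : ρ.s a * ρ.p Set.univ = ρ.s a := by
  conv_lhs => rw [← ρ.s_mul_p_pathRange a]
  rw [mul_assoc, ρ.p_inter _ (pathRange_mem_Ebar ω a) _ (univ_mem_Ebar ω), Set.inter_univ,
    ρ.s_mul_p_pathRange]

/-- The sum of the generators `s a`. -/
def isometrySum : C := ∑ a, ρ.s a

theorem star_isometrySum_mul : star ρ.isometrySum * ρ.isometrySum = ρ.p Set.univ := by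
  rw [isometrySum, star_sum, Finset.sum_mul_sum, ← ρ.sum_p_pathRange]
  refine Finset.sum_congr rfl fun a _ => ?_
  rw [Finset.sum_eq_single_of_mem a (Finset.mem_univ a), ρ.star_s_mul_self]
  exact fun b _ hb => ρ.star_s_mul_of_ne a b hb.symm

theorem isometrySum_mul_p_pathRange (a : 𝒜) :
    ρ.isometrySum * ρ.p ((sequenceGraph ω).pathRange [a]) = ρ.s a := by
  rw [isometrySum, Finset.sum_mul, Finset.sum_eq_single_of_mem a (Finset.mem_univ a),
    ρ.s_mul_p_pathRange]
  exact fun b _ hb => ρ.s_mul_p_pathRange_of_ne hb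

/-- The mixed terms `s b * star (s a)` vanish because the sets `r(a)` and `r(b)` are disjoint: a
vertex has only one incoming edge. The diagonal terms form the sum in `p_eq_sum` for `univ`. -/
theorem isometrySum_mul_star : ρ.isometrySum * star ρ.isometrySum = ρ.p Set.univ := by
  classical
  have h1 : ∀ a, ρ.isometrySum * star (ρ.s a) = ρ.s a * star (ρ.s a) := fun a => by
    conv_lhs => rw [← ρ.s_mul_p_pathRange a, star_mul,
      (ρ.isStarProjection_p _ (pathRange_mem_Ebar ω a)).isSelfAdjoint.star_eq, ← mul_assoc,
      ρ.isometrySum_mul_p_pathRange]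
  have hfin := Set.toFinite ((sequenceGraph ω).labelsFrom Set.univ)
  rw [ρ.p_eq_sum _ (univ_mem_Ebar ω) hfin]
  conv_lhs => rw [isometrySum, star_sum, Finset.mul_sum]
  change ∑ a, ρ.isometrySum * star (ρ.s a) = _
  refine (Finset.sum_subset_zero_on_sdiff (Finset.subset_univ _) (fun a ha => ?_)
    fun a _ => ?_).symm
  -- The relation `p_eq_sum` omits letters that do not occur in `ω`; for these `r(a) = ∅`, so `s a`
  -- is zero.
  · have h0 : ρ.s a = 0 := by
      have hne : ∀ n, ω n ≠ a := fun n hn => by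
        simp only [Set.Finite.mem_toFinset, Finset.mem_sdiff, Finset.mem_univ, true_and] at ha
        exact ha ⟨n, trivial, hn⟩
      have h := ρ.s_mul_p_pathRange a
      rw [sequenceGraph_pathRange, show {n : ℤ | ω (n - 1) = a} = ∅ by ext n; simp [hne],
        ρ.p_empty, mul_zero] at h
      exact h.symm
    rw [h0, star_zero, mul_zero]
  · rw [h1, ← LabeledGraph.pathRange_eq_relRange_univ, ρ.s_mul_p_pathRange]

/-- Termwise this is `p_mul_s`, because `r(A, a) = r(a) ∩ (A + 1)`. -/
theorem p_mul_isometrySum {A : Set ℤ} (hA : A ∈ (sequenceGraph ω).Ebar) :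
    ρ.p A * ρ.isometrySum = ρ.isometrySum * ρ.p {n | n - 1 ∈ A} := by
  rw [isometrySum, Finset.mul_sum, Finset.sum_mul]
  refine Finset.sum_congr rfl fun a _ => ?_
  conv_rhs => rw [← ρ.s_mul_p_pathRange a]
  rw [ρ.p_mul_s A hA, mul_assoc, ρ.p_inter _ (pathRange_mem_Ebar ω a) _ (shift_mem_Ebar ω hA),
    sequenceGraph_relRange, sequenceGraph_pathRange, Set.inter_comm]
  rfl

theorem star_isometrySum_conj {A : Set ℤ} (hA : A ∈ (sequenceGraph ω).Ebar) :
    star ρ.isometrySum * ρ.p A * ρ.isometrySum = ρ.p {n | n - 1 ∈ A} := by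
  rw [mul_assoc, ρ.p_mul_isometrySum hA, ← mul_assoc, ρ.star_isometrySum_mul,
    ρ.p_inter _ (univ_mem_Ebar ω) _ (shift_mem_Ebar ω hA), Set.univ_inter]

end NonUnital

/-! ### The covariant homomorphism of a unital representation -/

section Unital

variable {𝒜 : Type u} {ω : ℤ → 𝒜} {D : Type v} [CStarAlgebra D] [Fintype 𝒜]
  (ρ : (sequenceGraph ω).Representation (sequenceGraph ω).Ebar D)

theorem star_isometrySum_mem_unitary (h1 : ρ.p Set.univ = 1) : star ρ.isometrySum ∈ unitary D := by
  rw [Unitary.mem_iff, star_star, ρ.star_isometrySum_mul, ρ.isometrySum_mul_star]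
  exact ⟨h1, h1⟩

variable (h1 : ρ.p Set.univ = 1)

/-- Conjugation by the adjoint of the sum of the generators. -/
def conjAut : D ≃⋆ₐ[ℂ] D :=
  Unitary.conjStarAlgAut ℂ D ⟨star ρ.isometrySum, ρ.star_isometrySum_mem_unitary h1⟩

theorem conjAut_apply (x : D) :
    ρ.conjAut h1 x = star ρ.isometrySum * x * ρ.isometrySum := by
  rw [conjAut, Unitary.conjStarAlgAut_apply, star_star]

theorem conjAut_pow_p (m : ℕ) {A : Set ℤ} (hA : A ∈ (sequenceGraph ω).Ebar) :
    {n : ℤ | n - m ∈ A} ∈ (sequenceGraph ω).Ebar ∧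
      (ρ.conjAut h1 ^ m) (ρ.p A) = ρ.p {n : ℤ | n - m ∈ A} := by
  induction m with
  | zero => simpa using hA
  | succ m ih =>
    have hs : {n | n - ((m + 1 : ℕ) : ℤ) ∈ A} = {n | n - 1 ∈ {n | n - (m : ℤ) ∈ A}} := by
      ext n
      simp only [Set.mem_ofPred_eq]
      rw [show n - ((m + 1 : ℕ) : ℤ) = n - 1 - m by push_cast; ring]
    rw [hs, pow_succ']
    refine ⟨shift_mem_Ebar ω ih.1, ?_⟩
    rw [← ρ.star_isometrySum_conj ih.1, ← ih.2]
    exact ρ.conjAut_apply h1 _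

/-- The projection of the cylinder set `{x | x i = a}`. -/
def coordProj (i : ℤ) (a : 𝒜) : D :=
  -- Coordinate `-1` is `p (r(a))`, and `conjAut` lowers the coordinate by one; this fixes the
  -- exponent.
  (ρ.conjAut h1 ^ (-(i + 1))) (ρ.p ((sequenceGraph ω).pathRange [a]))

theorem coordProj_neg_one (a : 𝒜) :
    ρ.coordProj h1 (-1) a = ρ.p ((sequenceGraph ω).pathRange [a]) := by
  simp [coordProj]

theorem conjAut_zpow_coordProj (k i : ℤ) (a : 𝒜) :
    (ρ.conjAut h1 ^ k) (ρ.coordProj h1 i a) = ρ.coordProj h1 (i - k) a := by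
  rw [coordProj, coordProj, show -(i - k + 1) = k + -(i + 1) by ring, zpow_add]
  rfl

/-- For negative `i` the exponent `-(i + 1)` is a natural number, so only forward translates are
needed, and these stay in `Ebar`. -/
theorem coordProj_of_neg {i : ℤ} (hi : i < 0) (a : 𝒜) :
    {n | ω (i + n) = a} ∈ (sequenceGraph ω).Ebar ∧
      ρ.coordProj h1 i a = ρ.p {n | ω (i + n) = a} := by
  obtain ⟨m, hm⟩ := Int.eq_ofNat_of_zero_le (show 0 ≤ -(i + 1) by lia)
  have h := ρ.conjAut_pow_p h1 m (pathRange_mem_Ebar ω a)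
  have hs : {n : ℤ | n - m ∈ (sequenceGraph ω).pathRange [a]} = {n | ω (i + n) = a} := by
    ext n
    rw [sequenceGraph_pathRange]
    simp only [Set.mem_ofPred_eq]
    rw [show n - (m : ℤ) - 1 = i + n by lia]
  rw [hs] at h
  rw [coordProj, hm, zpow_natCast]
  exact h

theorem list_prod_p (h1 : ρ.p Set.univ = 1) {l : List ℤ} {B : ℤ → Set ℤ} (hB : ∀ i ∈ l, B i ∈ (sequenceGraph ω).Ebar) :
    (⋂ i ∈ l, B i) ∈ (sequenceGraph ω).Ebar ∧
      (l.map fun i => ρ.p (B i)).prod = ρ.p (⋂ i ∈ l, B i) := by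
  induction l with
  | nil => simpa using ⟨univ_mem_Ebar ω, h1.symm⟩
  | cons i l ih =>
    have ih := ih fun j hj => hB j (List.mem_cons_of_mem i hj)
    have hi := hB i List.mem_cons_self
    have hs : (⋂ j ∈ i :: l, B j) = B i ∩ ⋂ j ∈ l, B j := by
      ext n; simp
    rw [hs, List.map_cons, List.prod_cons, ih.2, ρ.p_inter _ hi _ ih.1]
    exact ⟨(isNormalAccommodating_Ebar ω).inter_mem _ hi _ ih.1, rfl⟩

theorem coordProj_mul_comm (i j : ℤ) (a b : 𝒜) :
    ρ.coordProj h1 i a * ρ.coordProj h1 j b = ρ.coordProj h1 j b * ρ.coordProj h1 i a := by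
  -- This power makes both coordinates negative, where the projections are values of `p` and
  -- commute.
  apply EquivLike.injective (ρ.conjAut h1 ^ (|i| + |j| + 1))
  have hi : i - (|i| + |j| + 1) < 0 := by have := le_abs_self i; have := abs_nonneg j; lia
  have hj : j - (|i| + |j| + 1) < 0 := by have := le_abs_self j; have := abs_nonneg i; lia
  obtain ⟨hi1, hi2⟩ := ρ.coordProj_of_neg h1 hi a
  obtain ⟨hj1, hj2⟩ := ρ.coordProj_of_neg h1 hj b
  rw [map_mul, map_mul, conjAut_zpow_coordProj, conjAut_zpow_coordProj, hi2, hj2,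
    ρ.p_inter _ hi1 _ hj1, ρ.p_inter _ hj1 _ hi1, Set.inter_comm]

/-- Once all coordinates are moved to the negative side, the product is `p` of the set of places
where the word occurs, which is empty. -/
theorem coordProj_word (w : ℤ → 𝒜) (l : List ℤ) (h : ∀ n, ∃ i ∈ l, ω (i + n) ≠ w i) :
    (l.map fun i => ρ.coordProj h1 i (w i)).prod = 0 := by
  obtain ⟨N, hN⟩ : ∃ N : ℤ, ∀ i ∈ l, i - N < 0 := by
    obtain ⟨N, hN⟩ := l.toFinset.bddAbove
    exact ⟨N + 1, fun i hi => by have := hN (List.mem_toFinset.mpr hi); lia⟩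
  apply EquivLike.injective (ρ.conjAut h1 ^ N)
  rw [map_list_prod, List.map_map, map_zero]
  have he : l.map ((ρ.conjAut h1 ^ N) ∘ fun i => ρ.coordProj h1 i (w i)) =
      l.map fun i => ρ.p {n | ω (i - N + n) = w i} :=
    List.map_congr_left fun i hi => by
      rw [Function.comp_apply, conjAut_zpow_coordProj, (ρ.coordProj_of_neg h1 (hN i hi) (w i)).2]
  rw [he, (ρ.list_prod_p h1 fun i hi => (ρ.coordProj_of_neg h1 (hN i hi) (w i)).1).2,
    ← ρ.p_empty]
  congr 1
  ext n
  simp only [Set.mem_iInter, Set.mem_ofPred_eq, Set.mem_empty_iff_false, iff_false, not_forall]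
  obtain ⟨i, hi, hne⟩ := h (n - N)
  refine ⟨i, hi, ?_⟩
  rwa [show i - N + n = i + (n - N) by ring]

variable [TopologicalSpace 𝒜] [DiscreteTopology 𝒜]

/-- The homomorphism on `C(X)` that belongs to a representation. -/
theorem exists_covariant_hom : ∃ φ : C(Subshift.orbitClosure ω, ℂ) →⋆ₐ[ℂ] D,
    (∀ f, ρ.conjAut h1 (φ f) = φ (f.comp
      ((Subshift.orbitShift ω).symm : C(Subshift.orbitClosure ω, Subshift.orbitClosure ω)))) ∧
    (∀ a, φ (Subshift.coord ω (-1) a) = ρ.p ((sequenceGraph ω).pathRange [a])) ∧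
    ∀ A ∈ (sequenceGraph ω).Ebar, φ (Subshift.charFun ω A) = ρ.p A := by
  obtain ⟨φ, hφ⟩ := Subshift.exists_hom_coord ω (ρ.coordProj h1)
    (fun i a => (ρ.isStarProjection_p _ (pathRange_mem_Ebar ω a)).map _)
    (ρ.coordProj_mul_comm h1)
    (fun i => by
      simp only [coordProj]
      rw [← map_sum, ρ.sum_p_pathRange, h1, map_one])
    (fun i a b hab => by
      rw [coordProj, coordProj, ← map_mul, ρ.p_mul_p_of_disjoint (pathRange_mem_Ebar ω a)
        (pathRange_mem_Ebar ω b) (pathRange_inter_of_ne hab), map_zero])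
    (ρ.coordProj_word h1)
  have hc : ∀ a, φ (Subshift.coord ω (-1) a) = ρ.p ((sequenceGraph ω).pathRange [a]) := fun a => by
    rw [hφ, coordProj_neg_one]
  have hcov : ∀ f, ρ.conjAut h1 (φ f) = φ (f.comp
      ((Subshift.orbitShift ω).symm : C(Subshift.orbitClosure ω, Subshift.orbitClosure ω))) := by
    refine Subshift.hom_ext_coord ω
      (φ := (((ρ.conjAut h1 : D →⋆ₐ[ℂ] D).comp φ : C(Subshift.orbitClosure ω, ℂ) →⋆ₐ[ℂ] D) :
        C(Subshift.orbitClosure ω, ℂ) →⋆ₙₐ[ℂ] D))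
      (ψ := ((φ.comp (ContinuousMap.compStarAlgHom' ℂ ℂ ((Subshift.orbitShift ω).symm :
        C(Subshift.orbitClosure ω, Subshift.orbitClosure ω))) :
          C(Subshift.orbitClosure ω, ℂ) →⋆ₐ[ℂ] D) : C(Subshift.orbitClosure ω, ℂ) →⋆ₙₐ[ℂ] D)) ?_
    intro i a
    change ρ.conjAut h1 (φ (Subshift.coord ω i a)) = φ ((Subshift.coord ω i a).comp _)
    rw [Subshift.coord_comp_orbitShift_symm, hφ, hφ, ← conjAut_zpow_coordProj, zpow_one]
  refine ⟨φ, hcov, hc, fun A hA => ?_⟩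
  -- Only the projections `p (r(a))` are matched so far. Covariance handles relative ranges, and
  -- multiplicativity the Boolean operations.
  refine Ebar_induction ω (P := fun A => φ (Subshift.charFun ω A) = ρ.p A)
    ?_ ?_ ?_ ?_ ?_ ?_ hA
  · rw [Subshift.Represents.univ.charFun_eq, map_one, h1]
  · rw [Subshift.Represents.empty.charFun_eq, map_zero, ρ.p_empty]
  · intro A hA h a
    rw [((Subshift.represents_charFun hA).relRange a).charFun_eq, map_mul, ← hcov, h, hc,
      conjAut_apply, ρ.star_isometrySum_conj hA,
      ρ.p_inter _ (shift_mem_Ebar ω hA) _ (pathRange_mem_Ebar ω a),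
      sequenceGraph_relRange, sequenceGraph_pathRange]
    rfl
  · intro A hA B hB h h'
    rw [((Subshift.represents_charFun hA).inter (Subshift.represents_charFun hB)).charFun_eq,
      map_mul, h, h', ρ.p_inter A hA B hB]
  · intro A hA B hB h h'
    rw [((Subshift.represents_charFun hA).union (Subshift.represents_charFun hB)).charFun_eq,
      map_sub, map_add, map_mul, h, h', ρ.p_union A hA B hB, ρ.p_inter A hA B hB]
  · intro A hA B hB h h'
    rw [((Subshift.represents_charFun hA).diff (Subshift.represents_charFun hB)).charFun_eq,
      map_sub, map_mul, h, h', ρ.p_diff hA hB]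

end Unital

/-! ### Reduction of arbitrary representations to unital ones -/

section Lift

variable {𝒜 : Type u} {ω : ℤ → 𝒜}

/-- A representation with values in the range of an injective homomorphism factors. -/
theorem exists_lift {C D : Type v} [NonUnitalCStarAlgebra C] [NonUnitalCStarAlgebra D]
    (ρ : (sequenceGraph ω).Representation (sequenceGraph ω).Ebar C) (ι : D →⋆ₙₐ[ℂ] C)
    (hι : Function.Injective ι) (hs : ∀ a, ∃ d, ι d = ρ.s a)
    (hp : ∀ A ∈ (sequenceGraph ω).Ebar, ∃ d, ι d = ρ.p A) :
    ∃ σ : (sequenceGraph ω).Representation (sequenceGraph ω).Ebar D,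
      (∀ a, ι (σ.s a) = ρ.s a) ∧ ∀ A ∈ (sequenceGraph ω).Ebar, ι (σ.p A) = ρ.p A := by
  classical
  have hE := isNormalAccommodating_Ebar ω
  choose s hs using hs
  have hp' : ∀ A, ∃ d, A ∈ (sequenceGraph ω).Ebar → ι d = ρ.p A := fun A => by
    by_cases hA : A ∈ (sequenceGraph ω).Ebar
    · obtain ⟨d, hd⟩ := hp A hA
      exact ⟨d, fun _ => hd⟩
    · exact ⟨0, fun h => absurd h hA⟩
  choose p hp using hp'
  refine ⟨{
    s := s
    p := p
    isStarProjection_p := fun A hA => ⟨hι ?_, hι ?_⟩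
    partialIsometry_s := fun a => hι ?_
    p_empty := hι ?_
    p_inter := fun A hA B hB => hι ?_
    p_union := fun A hA B hB => hι ?_
    p_mul_s := fun A hA a => hι ?_
    star_s_mul_self := fun a => hι ?_
    star_s_mul_of_ne := fun a b hab => hι ?_
    p_eq_sum := fun A hA h => hι ?_ }, hs, hp⟩
  · rw [map_mul, hp A hA]
    exact (ρ.isStarProjection_p A hA).isIdempotentElem
  · rw [map_star, hp A hA]
    exact (ρ.isStarProjection_p A hA).isSelfAdjoint
  · rw [map_mul, map_mul, map_star, hs, ρ.partialIsometry_s]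
  · rw [hp _ (empty_mem_Ebar ω), map_zero, ρ.p_empty]
  · rw [map_mul, hp A hA, hp B hB, hp _ (hE.inter_mem A hA B hB), ρ.p_inter A hA B hB]
  · rw [map_sub, map_add, hp A hA, hp B hB, hp _ (hE.inter_mem A hA B hB),
      hp _ (hE.union_mem A hA B hB), ρ.p_union A hA B hB]
  · rw [map_mul, map_mul, hs, hp A hA, hp _ (relRange_mem_Ebar ω hA a), ρ.p_mul_s A hA]
  · rw [map_mul, map_star, hs, hp _ (pathRange_mem_Ebar ω a), ρ.star_s_mul_self]
  · rw [map_mul, map_star, hs, hs, ρ.star_s_mul_of_ne a b hab, map_zero]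
  · rw [map_sum, hp A hA, ρ.p_eq_sum A hA h]
    refine Finset.sum_congr rfl fun a _ => ?_
    rw [map_mul, map_mul, map_star, hs, hp _ (relRange_mem_Ebar ω hA a)]

/-- In the corner of `p univ` the sum of the generators is the unitary `U*`, and `s a` is recovered
as `U* · p (r(a))`. This drives the injectivity of `toCrossedProduct`. -/
theorem exists_covariantIndex [TopologicalSpace 𝒜] [DiscreteTopology 𝒜] [Fintype 𝒜] {C : Type u} [NonUnitalCStarAlgebra C]
    (ρ : (sequenceGraph ω).Representation (sequenceGraph ω).Ebar C) :
    ∃ (j : CrossedProduct.CovariantIndex (Subshift.orbitShift ω)) (ι : j.alg →⋆ₙₐ[ℂ] C),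
      (∀ a, ι (star j.U * j.φ (Subshift.coord ω (-1) a)) = ρ.s a) ∧
      ∀ A ∈ (sequenceGraph ω).Ebar, ι (j.φ (Subshift.charFun ω A)) = ρ.p A := by
  have hpu := univ_mem_Ebar ω
  obtain ⟨D, _, ι, hι, hι1, hcorner⟩ := exists_corner (ρ.isStarProjection_p _ hpu)
  obtain ⟨σ, hσs, hσp⟩ := ρ.exists_lift ι hι
    (fun a => hcorner _ (ρ.p_univ_mul_s a) (ρ.s_mul_p_univ a))
    (fun A hA => hcorner _ (by rw [ρ.p_inter _ hpu _ hA, Set.univ_inter])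
      (by rw [ρ.p_inter _ hA _ hpu, Set.inter_univ]))
  have h1 : σ.p Set.univ = 1 := hι (by rw [hσp _ hpu, hι1])
  obtain ⟨φ, hcov, hc, hchar⟩ := σ.exists_covariant_hom h1
  refine ⟨{ alg := D
            φ := φ
            U := star σ.isometrySum
            U_mem := σ.star_isometrySum_mem_unitary h1
            covariant := fun f => ?_ }, ι, fun a => ?_, fun A hA => ?_⟩
  · rw [← hcov, conjAut_apply, star_star]
  · rw [← hσs a, ← σ.isometrySum_mul_p_pathRange a, ← hc]
    exact congrArg (fun x => ι (x * φ (Subshift.coord ω (-1) a))) (star_star σ.isometrySum)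
  · exact (congrArg ι (hchar A hA)).trans (hσp A hA)

end Lift

end LabeledGraph.Representation

/-! ### From covariant representations to representations -/


namespace CrossedProduct.CovariantIndex

variable {X : Type u} [TopologicalSpace X] {T : X ≃ₜ X} (j : CovariantIndex T)

theorem star_U_mul_U : star j.U * j.U = 1 := Unitary.star_mul_self_of_mem j.U_mem

theorem U_mul_star_U : j.U * star j.U = 1 := Unitary.mul_star_self_of_mem j.U_mem

theorem φ_mul_star_U (f : C(X, ℂ)) :
    j.φ f * star j.U = star j.U * j.φ (f.comp (T.symm : C(X, X))) := by
  rw [← j.covariant, ← mul_assoc, ← mul_assoc, j.star_U_mul_U, one_mul]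

theorem star_U_mul_φ_mul_U (f : C(X, ℂ)) :
    star j.U * j.φ (f.comp (T.symm : C(X, X))) * j.U = j.φ f := by
  rw [← j.φ_mul_star_U, mul_assoc, j.star_U_mul_U, mul_one]

end CrossedProduct.CovariantIndex

namespace Subshift

variable {𝒜 : Type u} [TopologicalSpace 𝒜] {ω : ℤ → 𝒜}

theorem Represents.star {f : C(orbitClosure ω, ℂ)} {A : Set ℤ} (hf : Represents ω f A) :
    Represents ω (star f) A := fun n => by
  rw [ContinuousMap.star_apply, hf n]
  by_cases h : n ∈ A <;> simp [h]

variable [DiscreteTopology 𝒜] [Finite 𝒜] (j : CrossedProduct.CovariantIndex (orbitShift ω))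

/-- The representation of the labeled space of `ω` that belongs to a covariant representation. -/
def repOfCovariant : (sequenceGraph ω).Representation (sequenceGraph ω).Ebar j.alg where
  s a := star j.U * j.φ (coord ω (-1) a)
  p A := j.φ (charFun ω A)
  isStarProjection_p A hA := by
    have h := represents_charFun hA
    refine IsStarProjection.map ⟨?_, ?_⟩ j.φ
    · have h2 := h.inter h
      rw [Set.inter_self] at h2
      exact h2.charFun_eq.symm
    · exact h.star.charFun_eq.symm
  partialIsometry_s a := by
    rw [star_mul, star_star, ← map_star, star_coord]
    calc _ = star j.U * (j.φ (coord ω (-1) a) * j.φ (coord ω (-1) a)) * (j.U * star j.U) *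
        j.φ (coord ω (-1) a) := by simp only [mul_assoc]
      _ = _ := by
        rw [j.U_mul_star_U, mul_one, ← map_mul, coord_mul_self, mul_assoc, ← map_mul,
          coord_mul_self]
  p_empty := by rw [Represents.empty.charFun_eq, map_zero]
  p_inter A hA B hB := by
    rw [((represents_charFun hA).inter (represents_charFun hB)).charFun_eq, map_mul]
  p_union A hA B hB := by
    rw [((represents_charFun hA).inter (represents_charFun hB)).charFun_eq,
      ((represents_charFun hA).union (represents_charFun hB)).charFun_eq, map_sub, map_add]
  p_mul_s A hA a := by
    rw [((represents_charFun hA).relRange a).charFun_eq, ← mul_assoc, j.φ_mul_star_U, mul_assoc,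
      mul_assoc, ← map_mul, ← map_mul, mul_left_comm, coord_mul_self]
  star_s_mul_self a := by
    rw [star_mul, star_star, ← map_star, star_coord, (represents_coord_neg_one a).charFun_eq,
      mul_assoc, ← mul_assoc j.U, j.U_mul_star_U, one_mul, ← map_mul, coord_mul_self]
  star_s_mul_of_ne a b hab := by
    rw [star_mul, star_star, ← map_star, star_coord,
      mul_assoc, ← mul_assoc j.U, j.U_mul_star_U, one_mul, ← map_mul, coord_mul_of_ne ω _ hab,
      map_zero]
  p_eq_sum A hA hfin := by
    have := Fintype.ofFinite 𝒜
    have hf := represents_charFun hA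
    have hterm : ∀ a, star j.U * j.φ (coord ω (-1) a) *
        j.φ (charFun ω ((sequenceGraph ω).relRange A [a])) *
        star (star j.U * j.φ (coord ω (-1) a)) =
        star j.U * j.φ (charFun ω ((sequenceGraph ω).relRange A [a])) * j.U := fun a => by
      rw [(hf.relRange a).charFun_eq, star_mul, star_star, ← map_star, star_coord,
        mul_assoc (star j.U), ← map_mul, mul_left_comm, coord_mul_self, ← mul_assoc,
        mul_assoc (star j.U), ← map_mul, mul_assoc _ (coord ω (-1) a), coord_mul_self]
    simp only [hterm]
    -- Labels that do not start in `A` have empty relative range, so the sum may run over all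
    -- letters, where the cylinder functions add up to `1`.
    rw [Finset.sum_subset (Finset.subset_univ hfin.toFinset)]
    · rw [← Finset.sum_mul, ← Finset.mul_sum, ← map_sum,
        Finset.sum_congr rfl fun a _ => (hf.relRange a).charFun_eq, ← Finset.mul_sum, sum_coord,
        mul_one, j.star_U_mul_φ_mul_U]
    · intro a _ ha
      have h0 : (sequenceGraph ω).relRange A [a] = ∅ := by
        ext n
        simp only [LabeledGraph.mem_relRange_singleton, Set.mem_empty_iff_false, iff_false]
        rintro ⟨e, he, hs, -⟩
        exact ha (hfin.mem_toFinset.mpr ⟨e, hs, he⟩)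
      rw [h0, Represents.empty.charFun_eq, map_zero, mul_zero, zero_mul]

/-! ### The homomorphism to the crossed product and its injectivity -/

variable (ω)

/-- The family of the values of `x` at the representations that come from covariant
representations. -/
def toCovariantProduct : (sequenceGraph ω).RepProduct (sequenceGraph ω).Ebar →⋆ₙₐ[ℂ]
    CrossedProduct.CovariantProduct (orbitShift ω) where
  toFun x := ⟨fun j => x ⟨j.alg, repOfCovariant j⟩, memℓp_infty ⟨‖x‖, by
    rintro _ ⟨j, rfl⟩
    exact lp.norm_apply_le_norm ENNReal.top_ne_zero x ⟨j.alg, repOfCovariant j⟩⟩⟩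
  map_smul' _ _ := rfl
  map_zero' := rfl
  map_add' _ _ := rfl
  map_mul' _ _ := rfl
  map_star' _ := rfl

theorem toCovariantProduct_mem {x : (sequenceGraph ω).RepProduct (sequenceGraph ω).Ebar}
    (hx : x ∈ (sequenceGraph ω).generatedSubalgebra (sequenceGraph ω).Ebar) :
    toCovariantProduct ω x ∈ CrossedProduct.generatedSubalgebra (orbitShift ω) := by
  suffices h : (sequenceGraph ω).generatedSubalgebra (sequenceGraph ω).Ebar ≤
    (CrossedProduct.generatedSubalgebra (orbitShift ω)).comap (toCovariantProduct ω) from h hx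
  refine NonUnitalStarSubalgebra.topologicalClosure_minimal _ ?_ ?_
  · refine NonUnitalStarAlgebra.adjoin_le ?_
    rintro _ (⟨a, rfl⟩ | ⟨A, rfl⟩)
    · exact mul_mem (star_mem (CrossedProduct.prodU_mem _))
        (CrossedProduct.prodFun_mem _ (coord ω (-1) a))
    · exact CrossedProduct.prodFun_mem _ (charFun ω A)
  · exact (NonUnitalStarSubalgebra.isClosed_topologicalClosure _).preimage
      (map_continuous (toCovariantProduct ω))

/-- The canonical homomorphism of the labeled graph algebra to the crossed product. -/
def toCrossedProduct : (sequenceGraph ω).CStar (sequenceGraph ω).Ebar →⋆ₙₐ[ℂ]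
    CrossedProduct (orbitShift ω) where
  toFun x := ⟨toCovariantProduct ω x.1, toCovariantProduct_mem ω x.2⟩
  map_smul' _ _ := rfl
  map_zero' := rfl
  map_add' _ _ := rfl
  map_mul' _ _ := rfl
  map_star' _ := rfl

theorem toCrossedProduct_genS (a : 𝒜) :
    toCrossedProduct ω ((sequenceGraph ω).genS _ a) =
      star (CrossedProduct.genU (orbitShift ω)) * CrossedProduct.incl _ (coord ω (-1) a) := rfl

theorem toCrossedProduct_genP (A : (sequenceGraph ω).Ebar) :
    toCrossedProduct ω ((sequenceGraph ω).genP _ A) = CrossedProduct.incl _ (charFun ω A) := rfl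

/-- An element is the family of its values in all representations. Each value is the image under
some `ι` of the value at a representation `repOfCovariant j`, and the latter is a component of the
image in the crossed product. -/
theorem toCrossedProduct_injective : Function.Injective (toCrossedProduct ω) := by
  have := Fintype.ofFinite 𝒜
  rw [injective_iff_map_eq_zero]
  intro x hx
  refine Subtype.ext (lp.ext (funext fun i => ?_))
  obtain ⟨j, ι, hs, hp⟩ := i.rep.exists_covariantIndex
  let ev (i : (sequenceGraph ω).RepIndex (sequenceGraph ω).Ebar) :
      (sequenceGraph ω).RepProduct (sequenceGraph ω).Ebar →⋆ₙₐ[ℂ] i.alg :=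
    { toFun := fun y => y i
      map_smul' := fun _ _ => rfl
      map_zero' := rfl
      map_add' := fun _ _ => rfl
      map_mul' := fun _ _ => rfl
      map_star' := fun _ => rfl }
  let g := ι.comp (ev ⟨j.alg, repOfCovariant j⟩)
  have hle : (sequenceGraph ω).generatedSubalgebra (sequenceGraph ω).Ebar ≤
      NonUnitalStarAlgHom.equalizer g (ev i) := by
    refine NonUnitalStarSubalgebra.topologicalClosure_minimal _ ?_ ?_
    · refine NonUnitalStarAlgebra.adjoin_le ?_
      rintro _ (⟨a, rfl⟩ | ⟨A, rfl⟩)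
      · exact hs a
      · exact hp A A.2
    · exact isClosed_eq (map_continuous g) (map_continuous (ev i))
  have h1 : g x.1 = ev i x.1 := hle x.2
  have h2 : x.1 ⟨j.alg, repOfCovariant j⟩ = 0 :=
    congrArg (fun y : CrossedProduct (orbitShift ω) => y.1 j) hx
  change ev i x.1 = 0
  rw [← h1]
  exact (congrArg ι h2).trans (map_zero ι)

end Subshift

/-! ### Relations in the crossed product -/

namespace CrossedProduct

variable {X : Type u} [TopologicalSpace X] [CompactSpace X] (T : X ≃ₜ X)

theorem genU_mul_incl (f : C(X, ℂ)) :
    genU T * incl T f * star (genU T) = incl T (f.comp (T.symm : C(X, X))) :=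
  Subtype.ext <| lp.ext <| funext fun i => i.covariant f

theorem star_genU_mul_incl (f : C(X, ℂ)) :
    star (genU T) * incl T f * genU T = incl T (f.comp (T : C(X, X))) :=
  Subtype.ext <| lp.ext <| funext fun i => by
    have h := i.star_U_mul_φ_mul_U (f.comp (T : C(X, X)))
    rw [ContinuousMap.comp_assoc] at h
    refine Eq.trans ?_ h
    change star i.U * i.φ f * i.U = _
    congr 3
    ext x
    simp

theorem genU_mul_incl_one : star (genU T) * incl T 1 = star (genU T) :=
  Subtype.ext <| lp.ext <| funext fun i => by
    change star i.U * i.φ 1 = star i.U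
    rw [map_one, mul_one]

end CrossedProduct

/-! ### Surjectivity -/

namespace Subshift

variable {𝒜 : Type u} [TopologicalSpace 𝒜] [DiscreteTopology 𝒜] [Finite 𝒜] (ω : ℤ → 𝒜)

theorem toCrossedProduct_surjective : Function.Surjective (toCrossedProduct ω) := by
  have := Fintype.ofFinite 𝒜
  set R := NonUnitalStarAlgHom.range (toCrossedProduct ω) with hR
  have hRcl : IsClosed (R : Set (CrossedProduct (orbitShift ω))) := by
    -- An injective star homomorphism of C⋆-algebras is isometric, so its range is closed.
    rw [hR, NonUnitalStarAlgHom.coe_range]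
    exact (NonUnitalStarAlgHom.isometry _
      (toCrossedProduct_injective ω)).isClosedEmbedding.isClosed_range
  -- The cylinder functions at `-1` sum to `1`, so `U*` is the sum of the images of the `s_a`.
  have hU : CrossedProduct.genU (orbitShift ω) ∈ R := by
    rw [← star_mem_iff, ← CrossedProduct.genU_mul_incl_one, ← sum_coord ω (-1), map_sum,
      Finset.mul_sum]
    exact sum_mem fun a _ => ⟨(sequenceGraph ω).genS _ a, toCrossedProduct_genS ω a⟩
  have hc0 : ∀ a, CrossedProduct.incl (orbitShift ω) (coord ω (-1) a) ∈ R := fun a => by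
    rw [← (represents_coord_neg_one a).charFun_eq]
    exact ⟨(sequenceGraph ω).genP _ ⟨_, pathRange_mem_Ebar ω a⟩, toCrossedProduct_genP ω _⟩
  -- Conjugation by `U*` raises the coordinate and conjugation by `U` lowers it, so every coordinate
  -- is reached from `-1`.
  have hc : ∀ i a, CrossedProduct.incl (orbitShift ω) (coord ω i a) ∈ R := fun i a => by
    induction i using Int.inductionOn' (b := -1) with
    | zero => exact hc0 a
    | succ k _ ih =>
      have h := mul_mem (mul_mem (star_mem hU) ih) hU
      rw [CrossedProduct.star_genU_mul_incl] at h
      convert h using 2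
      ext x
      simp only [ContinuousMap.comp_apply, coord_apply]
      rfl
    | pred k _ ih =>
      have h := mul_mem (mul_mem hU ih) (star_mem hU)
      rwa [CrossedProduct.genU_mul_incl, coord_comp_orbitShift_symm] at h
  have hone : CrossedProduct.incl (orbitShift ω) 1 ∈ R := by
    rw [← sum_coord ω (-1), map_sum]
    exact sum_mem fun a _ => hc0 a
  have hf : ∀ f, CrossedProduct.incl (orbitShift ω) f ∈ R := by
    let S : StarSubalgebra ℂ C(orbitClosure ω, ℂ) :=
      { R.comap (CrossedProduct.incl (orbitShift ω)) with
        algebraMap_mem' := fun r => by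
          change CrossedProduct.incl (orbitShift ω) (algebraMap ℂ _ r) ∈ R
          rw [Algebra.algebraMap_eq_smul_one, map_smul]
          exact SMulMemClass.smul_mem r hone }
    have hS : S = ⊤ := eq_top_of_coord_mem ω S
      (hRcl.preimage (map_continuous (CrossedProduct.incl (orbitShift ω)))) hc
    intro f
    have : f ∈ S := hS ▸ StarSubalgebra.mem_top
    exact this
  intro y
  let sub := NonUnitalStarSubalgebraClass.subtype
    (CrossedProduct.generatedSubalgebra (orbitShift ω))
  have hle : CrossedProduct.generatedSubalgebra (orbitShift ω) ≤ R.map sub := by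
    refine NonUnitalStarSubalgebra.topologicalClosure_minimal _ ?_ ?_
    · refine NonUnitalStarAlgebra.adjoin_le ?_
      rintro _ (⟨f, rfl⟩ | rfl)
      · exact ⟨_, hf f, rfl⟩
      · exact ⟨_, hU, rfl⟩
    · exact ((NonUnitalStarSubalgebra.isClosed_topologicalClosure _).isClosedEmbedding_subtypeVal
        ).isClosedMap _ hRcl
  obtain ⟨z, hz, hzy⟩ := hle y.2
  obtain ⟨x, hx⟩ := hz
  exact ⟨x, hx.trans (Subtype.ext hzy)⟩

end Subshift

/-! ### The regular covariant representation -/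

namespace CrossedProduct

section Regular

variable {X : Type u}

/-- The Hilbert space `ℓ²(X)`. -/
abbrev L2 (X : Type u) : Type u := lp (fun _ : X => ℂ) 2

/-- The operator on `ℓ²(X)` of the permutation `e` of `X`. -/
def permOp (e : X ≃ X) : L2 X →L[ℂ] L2 X :=
  LinearMap.mkContinuous
    { toFun := fun ξ => ⟨fun x => ξ (e.symm x), memℓp_gen <| by
        have h := (lp.memℓp ξ).summable (by simp)
        exact e.symm.summable_iff.mpr h⟩
      map_add' := fun _ _ => rfl
      map_smul' := fun _ _ => rfl } 1 fun ξ => by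
    rw [one_mul, lp.norm_eq_tsum_rpow (by simp), lp.norm_eq_tsum_rpow (by simp)]
    exact le_of_eq (congrArg (· ^ _) (e.symm.tsum_eq fun x => ‖ξ x‖ ^ (2 : ℝ≥0∞).toReal))

theorem permOp_apply (e : X ≃ X) (ξ : L2 X) (x : X) : permOp e ξ x = ξ (e.symm x) := rfl

theorem star_permOp (e : X ≃ X) : star (permOp e) = permOp e.symm := by
  symm
  rw [ContinuousLinearMap.star_eq_adjoint, ContinuousLinearMap.eq_adjoint_iff]
  intro ξ η
  rw [lp.inner_eq_tsum, lp.inner_eq_tsum, ← e.symm.tsum_eq]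
  refine tsum_congr fun x => ?_
  rw [permOp_apply, permOp_apply, Equiv.symm_symm, Equiv.apply_symm_apply]

theorem permOp_mem_unitary (e : X ≃ X) : permOp e ∈ unitary (L2 X →L[ℂ] L2 X) := by
  rw [Unitary.mem_iff, star_permOp]
  constructor <;> ext ξ x <;> simp [permOp_apply]

variable [TopologicalSpace X] [CompactSpace X]

/-- The multiplication operator of `f` on `ℓ²(X)`. -/
def mulOp (f : C(X, ℂ)) : L2 X →L[ℂ] L2 X :=
  LinearMap.mkContinuous
    { toFun := fun ξ => ⟨fun x => f x * ξ x,
        ((lp.memℓp ξ).const_smul (‖f‖ : ℂ)).mono' fun x => by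
          rw [norm_mul, Pi.smul_apply, smul_eq_mul, norm_mul, Complex.norm_real, norm_norm]
          exact mul_le_mul_of_nonneg_right (f.norm_coe_le_norm x) (norm_nonneg _)⟩
      map_add' := fun ξ η => lp.ext <| funext fun x => mul_add (f x) (ξ x) (η x)
      map_smul' := fun c ξ => lp.ext <| funext fun x => mul_left_comm (f x) c (ξ x) } ‖f‖ fun ξ => by
    have h : ‖(‖f‖ : ℂ) • ξ‖ = ‖f‖ * ‖ξ‖ := by rw [norm_smul, Complex.norm_real, norm_norm]
    rw [← h]
    refine lp.norm_mono (by simp) fun x => ?_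
    change ‖f x * ξ x‖ ≤ ‖(‖f‖ : ℂ) * ξ x‖
    rw [norm_mul, norm_mul, Complex.norm_real, norm_norm]
    exact mul_le_mul_of_nonneg_right (f.norm_coe_le_norm x) (norm_nonneg _)

theorem mulOp_apply (f : C(X, ℂ)) (ξ : L2 X) (x : X) : mulOp f ξ x = f x * ξ x := rfl

/-- The representation of `C(X)` by multiplication operators. -/
def mulHom (X : Type u) [TopologicalSpace X] [CompactSpace X] :
    C(X, ℂ) →⋆ₐ[ℂ] (L2 X →L[ℂ] L2 X) where
  toFun := mulOp
  map_one' := by ext ξ x; simp [mulOp_apply]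
  map_mul' f g := by ext ξ x; simp [mulOp_apply, mul_assoc]
  map_zero' := by ext ξ x; simp [mulOp_apply]
  map_add' f g := by ext ξ x; simp [mulOp_apply, add_mul]
  commutes' r := by ext ξ x; simp [mulOp_apply, Algebra.algebraMap_eq_smul_one]
  map_star' f := by
    rw [ContinuousLinearMap.star_eq_adjoint, ContinuousLinearMap.eq_adjoint_iff]
    intro ξ η
    rw [lp.inner_eq_tsum, lp.inner_eq_tsum]
    refine tsum_congr fun x => ?_
    rw [mulOp_apply, mulOp_apply, RCLike.inner_apply, RCLike.inner_apply, map_mul,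
      ContinuousMap.star_apply, starRingEnd_apply, starRingEnd_apply, star_star]
    ring

theorem mulHom_apply (f : C(X, ℂ)) (ξ : L2 X) (x : X) : mulHom X f ξ x = f x * ξ x := rfl

/-- The covariant representation on `ℓ²(X)`. -/
def regularIndex (T : X ≃ₜ X) : CovariantIndex T where
  alg := L2 X →L[ℂ] L2 X
  φ := mulHom X
  U := permOp T.toEquiv
  U_mem := permOp_mem_unitary _
  covariant f := by
    rw [star_permOp]
    ext ξ x
    simp [permOp_apply, mulHom_apply]

/-- A multiplication operator on `ℓ²(X)` determines its symbol pointwise, by evaluation on the unit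
vectors of the points. -/
theorem incl_injective (T : X ≃ₜ X) : Function.Injective (incl T) := by
  classical
  intro f g hfg
  have h : mulHom X f = mulHom X g :=
    congrArg (fun y : CrossedProduct T => y.1 (regularIndex T)) hfg
  ext x
  have hx := congrArg (fun A : L2 X →L[ℂ] L2 X => A (lp.single 2 x 1) x) h
  simpa [mulHom_apply] using hx

end Regular

/-! ### The dual action -/

section Dual

variable {X : Type u} [TopologicalSpace X] {T : X ≃ₜ X}

/-- The covariant representation with the unitary multiplied by `z`. -/
def CovariantIndex.twist (j : CovariantIndex T) (z : Circle) : CovariantIndex T where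
  alg := j.alg
  φ := j.φ
  U := (z : ℂ) • j.U
  U_mem := by
    rw [Unitary.mem_iff, star_smul, smul_mul_smul_comm, smul_mul_smul_comm, circle_mul_star,
      circle_star_mul, j.star_U_mul_U, j.U_mul_star_U, one_smul]
    exact ⟨rfl, rfl⟩
  covariant f := by
    rw [star_smul, smul_mul_assoc, smul_mul_smul_comm, circle_mul_star, one_smul, j.covariant]

variable (T) in
/-- The dual action of the circle group. -/
def dualAct (z : Circle) : CovariantProduct T →⋆ₙₐ[ℂ] CovariantProduct T where
  toFun y := ⟨fun j => y (j.twist z), memℓp_infty ⟨‖y‖, by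
    rintro _ ⟨j, rfl⟩
    exact lp.norm_apply_le_norm ENNReal.top_ne_zero y (j.twist z)⟩⟩
  map_smul' _ _ := rfl
  map_zero' := rfl
  map_add' _ _ := rfl
  map_mul' _ _ := rfl
  map_star' _ := rfl

/-- The unitary of a covariant representation. -/
def CovariantIndex.unitaryU (j : CovariantIndex T) : unitary j.alg := ⟨j.U, j.U_mem⟩

theorem CovariantIndex.norm_zpow_le (j : CovariantIndex T) (k : ℤ) :
    ‖((j.unitaryU ^ k : unitary j.alg) : j.alg)‖ ≤ 1 :=
  norm_le_one_of_partialIsometry (by rw [Unitary.mul_star_self_of_mem (j.unitaryU ^ k).2, one_mul])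

theorem CovariantIndex.twist_zpow (j : CovariantIndex T) (z : Circle) (k : ℤ) :
    @Eq j.alg ((j.twist z).unitaryU ^ k).1
      (((z ^ k : Circle) : ℂ) • ((j.unitaryU ^ k : unitary j.alg) : j.alg)) := by
  induction k with
  | zero => simp; rfl
  | succ n ih =>
    rw [zpow_add_one, zpow_add_one, zpow_add_one, Submonoid.coe_mul, Submonoid.coe_mul,
      Circle.coe_mul]
    refine (congrArg (· * (z : ℂ) • j.U) ih).trans ?_
    rw [smul_mul_smul_comm]
    rfl
  | pred n ih =>
    rw [zpow_sub_one, zpow_sub_one, zpow_sub_one, Submonoid.coe_mul, Submonoid.coe_mul,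
      Circle.coe_mul]
    refine (congrArg (· * star ((z : ℂ) • j.U)) ih).trans ?_
    rw [star_smul, smul_mul_smul_comm, Circle.coe_inv_eq_conj]
    rfl

/-- Here `g` is `f ∘ T^{-k}`. That one `g` serves all `j` is what makes products and adjoints of
monomials monomials again. -/
theorem exists_zpow_mul (k : ℤ) : ∀ f : C(X, ℂ), ∃ g : C(X, ℂ), ∀ j : CovariantIndex T,
    ((j.unitaryU ^ k : unitary j.alg) : j.alg) * j.φ f =
      j.φ g * ((j.unitaryU ^ k : unitary j.alg) : j.alg) := by
  induction k with
  | zero => exact fun f => ⟨f, fun j => by simp⟩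
  | succ n ih =>
    intro f
    obtain ⟨g, hg⟩ := ih (f.comp (T.symm : C(X, X)))
    refine ⟨g, fun j => ?_⟩
    have h : j.U * j.φ f = j.φ (f.comp (T.symm : C(X, X))) * j.U := by
      rw [← j.covariant, mul_assoc _ (star j.U), j.star_U_mul_U, mul_one]
    rw [zpow_add_one, Submonoid.coe_mul, mul_assoc, show ((j.unitaryU : unitary j.alg) : j.alg) = j.U
      from rfl, h, ← mul_assoc, hg, mul_assoc]
  | pred n ih =>
    intro f
    obtain ⟨g, hg⟩ := ih (f.comp (T : C(X, X)))
    refine ⟨g, fun j => ?_⟩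
    have h : star j.U * j.φ f = j.φ (f.comp (T : C(X, X))) * star j.U := by
      rw [j.φ_mul_star_U]
      congr 2
      ext x
      simp
    rw [zpow_sub_one, Submonoid.coe_mul, mul_assoc,
      show ((j.unitaryU⁻¹ : unitary j.alg) : j.alg) = star j.U from rfl, h, ← mul_assoc, hg,
      mul_assoc]

/-- The average of the dual action over the `n`-th roots of unity. -/
def average (n : ℕ) (y : CovariantProduct T) : CovariantProduct T :=
  (n : ℂ)⁻¹ • ∑ m ∈ Finset.range n, dualAct T (Circle.exp (2 * Real.pi / n) ^ m) y

theorem average_add (n : ℕ) (x y : CovariantProduct T) :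
    average n (x + y) = average n x + average n y := by
  simp only [average, map_add, Finset.sum_add_distrib, smul_add]

theorem average_smul (n : ℕ) (c : ℂ) (x : CovariantProduct T) :
    average n (c • x) = c • average n x := by
  simp only [average, map_smul, ← Finset.smul_sum]
  rw [smul_comm]

theorem norm_average_le (n : ℕ) (x : CovariantProduct T) : ‖average n x‖ ≤ ‖x‖ := by
  rcases Nat.eq_zero_or_pos n with rfl | hn
  · simp [average]
  rw [average, norm_smul, norm_inv, Complex.norm_natCast]
  have h : ‖∑ m ∈ Finset.range n, dualAct T (Circle.exp (2 * Real.pi / n) ^ m) x‖ ≤ n * ‖x‖ := by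
    refine (norm_sum_le_of_le _ fun m _ => NonUnitalStarAlgHom.norm_apply_le _ x).trans ?_
    simp
  rw [inv_mul_le_iff₀ (by exact_mod_cast hn)]
  exact h

theorem average_eq_self {n : ℕ} (hn : n ≠ 0) {x : CovariantProduct T}
    (hx : ∀ z, dualAct T z x = x) : average n x = x := by
  simp only [average, hx, Finset.sum_const, Finset.card_range]
  rw [← Nat.cast_smul_eq_nsmul ℂ, smul_smul, inv_mul_cancel₀ (by exact_mod_cast hn), one_smul]

variable [CompactSpace X]

/-- The family of the elements `f U^k`. -/
def monomial (f : C(X, ℂ)) (k : ℤ) : CovariantProduct T :=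
  ⟨fun j => j.φ f * ((j.unitaryU ^ k : unitary j.alg) : j.alg), memℓp_infty ⟨‖f‖ * 1, by
    rintro _ ⟨j, rfl⟩
    exact (norm_mul_le _ _).trans (mul_le_mul (NonUnitalStarAlgHom.norm_apply_le j.φ f)
      (j.norm_zpow_le k) (norm_nonneg _) (norm_nonneg _))⟩⟩

theorem monomial_apply (f : C(X, ℂ)) (k : ℤ) (j : CovariantIndex T) :
    monomial f k j = j.φ f * ((j.unitaryU ^ k : unitary j.alg) : j.alg) := rfl

theorem monomial_zero (f : C(X, ℂ)) : monomial f 0 = prodFun T f :=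
  lp.ext <| funext fun j => by
    rw [monomial_apply, zpow_zero, OneMemClass.coe_one, mul_one]
    rfl

theorem monomial_one_one : monomial 1 1 = prodU T :=
  lp.ext <| funext fun j => by
    rw [monomial_apply, zpow_one, map_one, one_mul]
    rfl

theorem dualAct_monomial (z : Circle) (f : C(X, ℂ)) (k : ℤ) :
    dualAct T z (monomial f k) = ((z ^ k : Circle) : ℂ) • monomial f k :=
  lp.ext <| funext fun j => by
    refine (congrArg (j.φ f * ·) (j.twist_zpow z k)).trans ?_
    rw [mul_smul_comm]
    rfl

theorem exists_monomial_mul (f g : C(X, ℂ)) (k l : ℤ) : ∃ h : C(X, ℂ),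
    (monomial f k * monomial g l : CovariantProduct T) = monomial h (k + l) := by
  obtain ⟨g', hg⟩ := exists_zpow_mul (T := T) k g
  refine ⟨f * g', lp.ext <| funext fun j => ?_⟩
  change j.φ f * ((j.unitaryU ^ k : unitary j.alg) : j.alg) *
    (j.φ g * ((j.unitaryU ^ l : unitary j.alg) : j.alg)) = _
  rw [monomial_apply, zpow_add, Submonoid.coe_mul, map_mul, ← mul_assoc, mul_assoc (j.φ f), hg]
  simp only [mul_assoc]

theorem exists_star_monomial (f : C(X, ℂ)) (k : ℤ) : ∃ h : C(X, ℂ),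
    star (monomial f k : CovariantProduct T) = monomial h (-k) := by
  obtain ⟨g, hg⟩ := exists_zpow_mul (T := T) (-k) (star f)
  refine ⟨g, lp.ext <| funext fun j => ?_⟩
  rw [monomial_apply, ← hg]
  change star (j.φ f * ((j.unitaryU ^ k : unitary j.alg) : j.alg)) = _
  rw [star_mul, map_star, zpow_neg]
  rfl

variable (T) in
/-- The span of the elements `f U^k` is a star subalgebra. -/
def polynomials : NonUnitalStarSubalgebra ℂ (CovariantProduct T) where
  toSubmodule := Submodule.span ℂ (Set.range fun x : C(X, ℂ) × ℤ => monomial x.1 x.2)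
  mul_mem' {a b} ha hb := by
    induction ha, hb using Submodule.span_induction₂ with
    | mem_mem x y hx hy =>
      obtain ⟨x, rfl⟩ := hx
      obtain ⟨y, rfl⟩ := hy
      obtain ⟨h, hh⟩ := exists_monomial_mul (T := T) x.1 y.1 x.2 y.2
      exact Submodule.subset_span ⟨(h, x.2 + y.2), hh.symm⟩
    | zero_left y hy => rw [zero_mul]; exact Submodule.zero_mem _
    | zero_right x hx => rw [mul_zero]; exact Submodule.zero_mem _
    | add_left x y z _ _ _ h1 h2 => rw [add_mul]; exact Submodule.add_mem _ h1 h2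
    | add_right x y z _ _ _ h1 h2 => rw [mul_add]; exact Submodule.add_mem _ h1 h2
    | smul_left r x y _ _ h => rw [smul_mul_assoc]; exact Submodule.smul_mem _ r h
    | smul_right r x y _ _ h => rw [mul_smul_comm]; exact Submodule.smul_mem _ r h
  star_mem' {a} ha := by
    induction ha using Submodule.span_induction with
    | mem x hx =>
      obtain ⟨x, rfl⟩ := hx
      obtain ⟨h, hh⟩ := exists_star_monomial (T := T) x.1 x.2
      exact Submodule.subset_span ⟨(h, -x.2), hh.symm⟩
    | zero => rw [star_zero]; exact Submodule.zero_mem _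
    | add x y _ _ h1 h2 => rw [star_add]; exact Submodule.add_mem _ h1 h2
    | smul r x _ h => rw [star_smul]; exact Submodule.smul_mem _ _ h

variable (T) in
theorem generatedSubalgebra_le_closure :
    generatedSubalgebra T ≤ (polynomials T).topologicalClosure := by
  refine NonUnitalStarSubalgebra.topologicalClosure_mono (NonUnitalStarAlgebra.adjoin_le ?_)
  rintro _ (⟨f, rfl⟩ | rfl)
  · exact Submodule.subset_span ⟨(f, 0), monomial_zero f⟩
  · exact Submodule.subset_span ⟨(1, 1), monomial_one_one⟩

/-- The dual action scales `f U^k` by `z^k`. As `n` does not divide `k`, the geometric sum of the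
powers of `ζ^k ≠ 1` vanishes. -/
theorem average_monomial_eq_zero {n : ℕ} {k : ℤ} (hk : k ≠ 0) (hn : k.natAbs < n) (f : C(X, ℂ)) :
    average n (monomial f k : CovariantProduct T) = 0 := by
  have hn0 : n ≠ 0 := by lia
  have hζ : IsPrimitiveRoot (Circle.exp (2 * Real.pi / n) : ℂ) n := by
    rw [Circle.coe_exp]
    convert Complex.isPrimitiveRoot_exp n hn0 using 2
    push_cast
    ring
  set ζ := Circle.exp (2 * Real.pi / n)
  have hne : ((ζ ^ k : Circle) : ℂ) ≠ 1 := by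
    rw [Circle.coe_zpow, Ne, hζ.zpow_eq_one_iff_dvd]
    intro hdvd
    have := Nat.le_of_dvd (by lia) (Int.natCast_dvd.mp hdvd)
    lia
  have hsum : ∑ m ∈ Finset.range n, (((ζ ^ m) ^ k : Circle) : ℂ) = 0 := by
    have h := mul_geom_sum ((ζ ^ k : Circle) : ℂ) n
    have hpow : ((ζ ^ k : Circle) : ℂ) ^ n = 1 := by
      rw [Circle.coe_zpow, ← zpow_natCast, zpow_comm, zpow_natCast, hζ.pow_eq_one, one_zpow]
    rw [hpow, sub_self] at h
    have h0 := (mul_eq_zero.mp h).resolve_left (sub_ne_zero.mpr hne)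
    rw [← h0]
    refine Finset.sum_congr rfl fun m _ => ?_
    rw [← Circle.coe_pow, ← zpow_natCast, ← zpow_natCast, zpow_comm]
  rw [average]
  simp only [dualAct_monomial]
  rw [← Finset.sum_smul, hsum, zero_smul, smul_zero]

theorem average_monomial_zero {n : ℕ} (hn : n ≠ 0) (f : C(X, ℂ)) :
    average n (monomial f 0 : CovariantProduct T) = prodFun T f := by
  rw [average_eq_self hn fun z => ?_, monomial_zero]
  rw [dualAct_monomial, zpow_zero, Circle.coe_one, one_smul]

/-- A polynomial has finitely many degrees; once `n` exceeds their absolute values, the average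
leaves only the degree-zero part. Finite averages thus replace the Haar integral. -/
theorem exists_average_eq {y : CovariantProduct T} (hy : y ∈ polynomials T) :
    ∃ (f : C(X, ℂ)) (N : ℕ), ∀ n, N < n → average n y = prodFun T f := by
  change y ∈ Submodule.span ℂ _ at hy
  induction hy using Submodule.span_induction with
  | mem x hx =>
    obtain ⟨⟨f, k⟩, rfl⟩ := hx
    by_cases hk : k = 0
    · subst hk
      exact ⟨f, 0, fun n hn => average_monomial_zero (by lia) f⟩
    · exact ⟨0, k.natAbs, fun n hn => (average_monomial_eq_zero hk hn f).trans
        (congrArg Subtype.val (map_zero (incl T))).symm⟩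
  | zero => exact ⟨0, 0, fun n hn => by
      rw [average_eq_self (by lia) fun z => map_zero _]
      exact (congrArg Subtype.val (map_zero (incl T))).symm⟩
  | add x y _ _ hx hy =>
    obtain ⟨f, N, hf⟩ := hx
    obtain ⟨g, M, hg⟩ := hy
    refine ⟨f + g, max N M, fun n hn => ?_⟩
    rw [average_add, hf n (by lia), hg n (by lia)]
    exact (congrArg Subtype.val (map_add (incl T) f g)).symm
  | smul c x _ hx =>
    obtain ⟨f, N, hf⟩ := hx
    refine ⟨c • f, N, fun n hn => ?_⟩
    rw [average_smul, hf n hn]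
    exact (congrArg Subtype.val (map_smul (incl T) c f)).symm

/-- The fixed points of the dual action are the continuous functions on `X`. -/
theorem exists_incl_eq_of_fixed {y : CrossedProduct T} (hy : ∀ z, dualAct T z y.1 = y.1) :
    ∃ f, incl T f = y := by
  have hcl : IsClosed (Set.range (incl T)) :=
    (NonUnitalStarAlgHom.isometry _ (incl_injective T)).isClosedEmbedding.isClosed_range
  suffices h : y ∈ closure (Set.range (incl T)) by rwa [hcl.closure_eq] at h
  rw [Metric.mem_closure_iff]
  intro ε hε
  obtain ⟨x, hx, hxy⟩ := Metric.mem_closure_iff.mp (generatedSubalgebra_le_closure T y.2) ε hε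
  obtain ⟨f, N, hf⟩ := exists_average_eq hx
  refine ⟨_, ⟨f, rfl⟩, ?_⟩
  change dist y.1 (prodFun T f) < ε
  -- Averaging fixes `y`, sends the nearby polynomial `x` to `f`, and is contractive, so `f` is as
  -- close to `y` as `x` is.
  rw [← hf (N + 1) (by lia), ← average_eq_self (Nat.succ_ne_zero N) hy, dist_eq_norm]
  refine lt_of_le_of_lt ?_ hxy
  rw [dist_eq_norm]
  have h := norm_average_le (N + 1) (y.1 + (-1 : ℂ) • x)
  rw [average_add, average_smul] at h
  simpa [sub_eq_add_neg] using h

end Dual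

end CrossedProduct

/-! ### The gauge action and the dual action -/

theorem LabeledGraph.Representation.ext_generators {V : Type uV} {E : Type uE} {𝒜 : Type u}
    {G : LabeledGraph V E 𝒜} {𝓑 : Set (Set V)} {C : Type v} [NonUnitalCStarAlgebra C]
    {ρ σ : G.Representation 𝓑 C} (hs : ρ.s = σ.s) (hp : ρ.p = σ.p) : ρ = σ := by
  cases ρ
  cases σ
  subst hs hp
  rfl

namespace Subshift

variable {𝒜 : Type u} [TopologicalSpace 𝒜] [DiscreteTopology 𝒜] [Finite 𝒜] {ω : ℤ → 𝒜}

/-- The generators involve `U*`, so scaling `U` by `z` scales them by the conjugate `z⁻¹`. -/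
theorem repOfCovariant_twist (j : CrossedProduct.CovariantIndex (orbitShift ω)) (z : Circle) :
    repOfCovariant (j.twist z) = (repOfCovariant j).twist z⁻¹ := by
  refine LabeledGraph.Representation.ext_generators (funext fun a => ?_) rfl
  change star ((z : ℂ) • j.U) * j.φ (coord ω (-1) a) =
    ((z⁻¹ : Circle) : ℂ) • (star j.U * j.φ (coord ω (-1) a))
  rw [star_smul, smul_mul_assoc, Circle.coe_inv_eq_conj]
  rfl

theorem dualAct_toCrossedProduct (x : (sequenceGraph ω).CStar (sequenceGraph ω).Ebar)
    (z : Circle) : CrossedProduct.dualAct (orbitShift ω) z (toCrossedProduct ω x).1 =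
      (toCrossedProduct ω ((sequenceGraph ω).gauge _ z⁻¹ x)).1 :=
  lp.ext <| funext fun j =>
    congrArg (fun r : (sequenceGraph ω).Representation (sequenceGraph ω).Ebar j.alg =>
      (x.1 ⟨j.alg, r⟩ : j.alg)) (repOfCovariant_twist j z)

theorem dualAct_incl (z : Circle) (f : C(orbitClosure ω, ℂ)) :
    CrossedProduct.dualAct (orbitShift ω) z (CrossedProduct.incl (orbitShift ω) f).1 =
      (CrossedProduct.incl (orbitShift ω) f).1 := rfl

theorem mem_gaugeFixed_iff (x : (sequenceGraph ω).CStar (sequenceGraph ω).Ebar) :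
    x ∈ (sequenceGraph ω).gaugeFixed (sequenceGraph ω).Ebar ↔
      ∃ f, CrossedProduct.incl (orbitShift ω) f = toCrossedProduct ω x := by
  constructor
  · intro hx
    refine CrossedProduct.exists_incl_eq_of_fixed fun z => ?_
    rw [dualAct_toCrossedProduct, hx]
  · rintro ⟨f, hf⟩ z
    apply toCrossedProduct_injective ω
    have h := dualAct_toCrossedProduct x z⁻¹
    rw [inv_inv, ← hf, dualAct_incl, hf] at h
    exact Subtype.ext h.symm

end Subshift
end

/-! ### The isomorphism and its restriction to the fixed points -/

theorem theorem3p7 {𝒜 : Type*} [TopologicalSpace 𝒜] [DiscreteTopology 𝒜] [Finite 𝒜]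
    (h𝒜 : 2 ≤ Nat.card 𝒜) (ω : ℤ → 𝒜) (hω : IsCantorMinimal (Subshift.orbitShift ω)) :
    ∃ (π : (sequenceGraph ω).CStar (sequenceGraph ω).Ebar ≃⋆ₐ[ℂ]
          CrossedProduct (Subshift.orbitShift ω))
      (ρ : (sequenceGraph ω).gaugeFixed (sequenceGraph ω).Ebar ≃⋆ₐ[ℂ]
          C(Subshift.orbitClosure ω, ℂ)),
      ∀ x : (sequenceGraph ω).gaugeFixed (sequenceGraph ω).Ebar,
        π x = CrossedProduct.incl (Subshift.orbitShift ω) (ρ x) := by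
  let π : (sequenceGraph ω).CStar (sequenceGraph ω).Ebar ≃⋆ₐ[ℂ]
      CrossedProduct (Subshift.orbitShift ω) :=
    StarAlgEquiv.ofBijective (Subshift.toCrossedProduct ω)
      ⟨Subshift.toCrossedProduct_injective ω, Subshift.toCrossedProduct_surjective ω⟩
  have hπ : ∀ x, π x = Subshift.toCrossedProduct ω x := fun _ => rfl
  have hmem : ∀ x : (sequenceGraph ω).gaugeFixed (sequenceGraph ω).Ebar,
      ∃ f, CrossedProduct.incl (Subshift.orbitShift ω) f = π x :=
    fun x => (Subshift.mem_gaugeFixed_iff x.1).mp x.2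
  -- `F` is `π` followed by the inverse of `incl` on its range; its algebraic properties follow from
  -- those of `π`, as `incl` is injective.
  choose F hF using hmem
  have hinj := CrossedProduct.incl_injective (Subshift.orbitShift ω)
  let F' : (sequenceGraph ω).gaugeFixed (sequenceGraph ω).Ebar →⋆ₙₐ[ℂ]
      C(Subshift.orbitClosure ω, ℂ) :=
    { toFun := F
      map_smul' := fun c x => hinj <| by
        rw [hF, MonoidHom.id_apply, map_smul, hF]
        exact map_smul π c x.1
      map_zero' := hinj <| by
        rw [hF, map_zero]
        exact map_zero π
      map_add' := fun x y => hinj <| by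
        rw [hF, map_add, hF, hF]
        exact map_add π x.1 y.1
      map_mul' := fun x y => hinj <| by
        rw [hF, map_mul, hF, hF]
        exact map_mul π x.1 y.1
      map_star' := fun x => hinj <| by
        rw [hF, map_star, hF]
        exact map_star π x.1 }
  have hbij : Function.Bijective F' := by
    constructor
    · intro x y hxy
      have h : π x = π y := by
        rw [← hF, ← hF]
        exact congrArg _ hxy
      exact Subtype.ext (EquivLike.injective π h)
    · intro f
      obtain ⟨x, hx⟩ := EquivLike.surjective π (CrossedProduct.incl (Subshift.orbitShift ω) f)
      refine ⟨⟨x, (Subshift.mem_gaugeFixed_iff x).mpr ⟨f, hx.symm⟩⟩, hinj ?_⟩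
      exact (hF _).trans hx
  exact ⟨π, StarAlgEquiv.ofBijective F' hbij, fun x => (hF x).symm⟩
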